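/- Let $G=(V,E)$ be a finite simple undirected graph. For $S\subseteq V$, the size of the cut $(S,V\setminus S)$ is the number of edges of $G$ with exactly one endpoint in $S$, and the cut is connected if the induced subgraph $G[S]$ is connected (in particular $S\neq\emptyset$). \textsc{Connected Maximum Cut} is the problem: given $G$ and an integer $k$, decide whether $G$ has a connected cut of size at least $k$. Two vertices $u,v$ are true twins if they are adjacent and have the same closed neighbourhood, $N[u]=N[v]$. A set $X\subseteq V$ is a twin-cover of $G$ if every edge $\{u,v\}\in E$ satisfies $u\in X$, or $v\in X$, or $u,v$ are true twins. The twin-cover number $\mathrm{tc}=\mathrm{tc}(G)$ is the minimum size of a twin-cover of $G$. \textbf{Theorem.} \textsc{Connected Maximum Cut} can be solved in time $O^*\bigl(2^{2^{\mathrm{tc}}+\mathrm{tc}}\bigr)$. That is, there are a deterministic algorithm (a program of a uniform-cost random access machine with addition, truncated subtraction, indirect addressing and tests for zero, whose input is the number $n$ of vertices, the adjacency matrix of $G$, and $k$) and a polynomial $q$ such that, for every graph $G$ on $n$ vertices and every integer $k$, the algorithm decides correctly whether $G$ has a connected cut of size at least $k$, within at most $q(n)\cdot 2^{2^{\mathrm{tc}(G)}+\mathrm{tc}(G)}$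 steps. -/

import Mathlib

/-- The number of edges of `G` with exactly one endpoint in `S`, i.e. the size of the cut
`(S, V \ S)`. -/
noncomputable def SimpleGraph.cutSize {V : Type*} (G : SimpleGraph V) (S : Set V) : ℕ :=
  {e ∈ G.edgeSet | ∃ u ∈ S, ∃ v ∉ S, e = s(u, v)}.ncard

/-- The question asked by Connected Maximum Cut on the instance `(G, k)`: is there a vertex set
`S` inducing a connected subgraph such that the cut `(S, V \ S)` has size at least `k`? -/
def SimpleGraph.HasConnectedCut {V : Type*} (G : SimpleGraph V) (k : ℤ) : Prop :=
  ∃ S : Set V, (G.induce S).Connected ∧ k ≤ (G.cutSize S : ℤ)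

/-- True twins: adjacent vertices with the same closed neighbourhood. -/
def SimpleGraph.TrueTwins {V : Type*} (G : SimpleGraph V) (u v : V) : Prop :=
  G.Adj u v ∧ insert u (G.neighborSet u) = insert v (G.neighborSet v)

/-- `X` is a twin-cover: every edge meets `X` or joins two true twins. -/
def SimpleGraph.IsTwinCover {V : Type*} (G : SimpleGraph V) (X : Finset V) : Prop :=
  ∀ u v : V, G.Adj u v → u ∈ X ∨ v ∈ X ∨ G.TrueTwins u v

/-- The minimum size of a twin-cover of a finite graph (the set of all vertices is one). -/
noncomputable def SimpleGraph.twinCoverNumber {V : Type*} [Finite V] (G : SimpleGraph V) : ℕ :=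
  sInf {m | ∃ X : Finset V, G.IsTwinCover X ∧ X.card = m}

/-! A deterministic random access machine with uniform cost. The machine has registers holding
natural numbers and finitely many unbounded arrays of natural numbers with indirect addressing;
a program is a finite text, so it names only finitely many registers and arrays. The arithmetic
operations are addition and truncated subtraction only, control is structured, and every executed
instruction and every evaluated test takes one step. -/
namespace RAM

/-- Machine states: the contents `reg r` of register `r`, and the entry `mem A i` of array `A` at
address `i`. -/
@[ext] structure State where
  reg : ℕ → ℕ
  mem : ℕ → ℕ → ℕ

/-- Write the value `v` into register `r`. -/
def State.setReg (s : State) (r v : ℕ) : State :=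
  { s with reg := Function.update s.reg r v }

/-- Write the value `v` into array `A` at address `i`. -/
def State.setMem (s : State) (A i v : ℕ) : State :=
  { s with mem := Function.update s.mem A (Function.update (s.mem A) i v) }

/-- Programs. The letters `r`, `a`, `b` are register numbers and `A` is an array number. -/
inductive Program where
  /-- do nothing -/
  | skip
  /-- `r := c` -/
  | const (r c : ℕ)
  /-- `r := a + b` -/
  | add (r a b : ℕ)
  /-- `r := a - b`, which is `0` if `a < b` -/
  | sub (r a b : ℕ)
  /-- `r := A[a]` -/
  | load (r A a : ℕ)
  /-- `A[a] := r` -/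
  | store (A a r : ℕ)
  /-- first `p`, then `q` -/
  | seq (p q : Program)
  /-- if register `r` is nonzero then `p` else `q` -/
  | ite (r : ℕ) (p q : Program)
  /-- while register `r` is nonzero do `p` -/
  | while (r : ℕ) (p : Program)

/-- `Exec p s t s'`: started in state `s`, the program `p` halts after exactly `t` steps, in
state `s'`. -/
inductive Exec : Program → State → ℕ → State → Prop where
  | skip (s : State) : Exec .skip s 1 s
  | const (s : State) (r c : ℕ) : Exec (.const r c) s 1 (s.setReg r c)
  | add (s : State) (r a b : ℕ) : Exec (.add r a b) s 1 (s.setReg r (s.reg a + s.reg b))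
  | sub (s : State) (r a b : ℕ) : Exec (.sub r a b) s 1 (s.setReg r (s.reg a - s.reg b))
  | load (s : State) (r A a : ℕ) : Exec (.load r A a) s 1 (s.setReg r (s.mem A (s.reg a)))
  | store (s : State) (A a r : ℕ) :
      Exec (.store A a r) s 1 (s.setMem A (s.reg a) (s.reg r))
  | seq {p q : Program} {s₁ s₂ s₃ : State} {t₁ t₂ : ℕ} :
      Exec p s₁ t₁ s₂ → Exec q s₂ t₂ s₃ → Exec (.seq p q) s₁ (t₁ + t₂) s₃
  | ite_true {r : ℕ} {p q : Program} {s s' : State} {t : ℕ} :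
      s.reg r ≠ 0 → Exec p s t s' → Exec (.ite r p q) s (t + 1) s'
  | ite_false {r : ℕ} {p q : Program} {s s' : State} {t : ℕ} :
      s.reg r = 0 → Exec q s t s' → Exec (.ite r p q) s (t + 1) s'
  | while_true {r : ℕ} {p : Program} {s₁ s₂ s₃ : State} {t₁ t₂ : ℕ} :
      s₁.reg r ≠ 0 → Exec p s₁ t₁ s₂ → Exec (.while r p) s₂ t₂ s₃ →
        Exec (.while r p) s₁ (t₁ + t₂ + 1) s₃
  | while_false {r : ℕ} {p : Program} {s : State} :
      s.reg r = 0 → Exec (.while r p) s 1 s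

/-- The machine is deterministic: the running time and the final state are determined. -/
theorem Exec.deterministic {p : Program} {s s₁ : State} {t₁ : ℕ} (h₁ : Exec p s t₁ s₁) :
    ∀ {t₂ : ℕ} {s₂ : State}, Exec p s t₂ s₂ → t₁ = t₂ ∧ s₁ = s₂ := by
  induction h₁ with
  | seq _ _ ih₁ ih₂ =>
    rintro _ _ (_ | _ | _ | _ | _ | _ | ⟨h, h'⟩)
    obtain ⟨rfl, rfl⟩ := ih₁ h
    obtain ⟨rfl, rfl⟩ := ih₂ h'
    exact ⟨rfl, rfl⟩
  | ite_true hr _ ih =>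
    intro _ _ h
    cases h with
    | ite_true _ h => obtain ⟨rfl, rfl⟩ := ih h; exact ⟨rfl, rfl⟩
    | ite_false h0 _ => exact absurd h0 hr
  | ite_false hr _ ih =>
    intro _ _ h
    cases h with
    | ite_true h0 _ => exact absurd hr h0
    | ite_false _ h => obtain ⟨rfl, rfl⟩ := ih h; exact ⟨rfl, rfl⟩
  | while_true hr _ _ ih₁ ih₂ =>
    intro _ _ h
    cases h with
    | while_true _ h h' =>
      obtain ⟨rfl, rfl⟩ := ih₁ h
      obtain ⟨rfl, rfl⟩ := ih₂ h'
      exact ⟨rfl, rfl⟩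
    | while_false h0 => exact absurd h0 hr
  | while_false hr =>
    intro _ _ h
    cases h with
    | while_true h0 _ _ => exact absurd hr h0
    | while_false _ => exact ⟨rfl, rfl⟩
  | _ => intro _ _ h; cases h; exact ⟨rfl, rfl⟩

open scoped Classical in
/-- The initial state for the instance `(G, k)`: register `0` holds the number `n` of vertices,
registers `1` and `2` hold the positive and the negative part of `k`, array `0` holds the
adjacency matrix of `G` row by row, and everything else is `0`. -/
noncomputable def input {n : ℕ} (G : SimpleGraph (Fin n)) (k : ℤ) : State where
  reg r := if r = 0 then n else if r = 1 then k.toNat else if r = 2 then (-k).toNat else 0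
  mem A a := if A = 0 ∧ ∃ i j : Fin n, G.Adj i j ∧ a = (i : ℕ) * n + (j : ℕ) then 1 else 0

end RAM

/-! Outside a twin-cover `X`, adjacent vertices are true twins, so each component there is a clique
of twins, and moving a single vertex `v` into a set `A` changes the cut by `deg v - 2 * degIn v A`.
Once the trace on `X` and a few vertices needed for connectivity are fixed, a greedy choice of the
remaining vertices is therefore optimal.

Let `S` be connected and meet `X` in `a`. In a breadth first tree of `S` rooted at `a`, every vertex
of `S` outside `X` has its parent in `X`. Hence `S ∩ X` is held together by the parents outside `X`
of vertices `x ≠ a` of `S ∩ X`, and such a parent may be replaced by the vertex of largest degree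
with the same neighbours in `X`. One relation on `X` records everything: row `a` is `S ∩ X`, and row
`x` is the neighbourhood in `X` of the parent of `x`. If `S` avoids `X`, it is a clique and the
start `{a}` suffices. `exists_bfs_tree` and `exists_start` give this, and `cutSum_le_of_greedy`
proves by an exchange argument that greedy enlargement of the start cuts at least as many edges as
`S`.

The algorithm tries all relations and all `a`. Taking both ends of uncovered edges gives `|X| ≤ 2
tc`, so there are at most `2 ^ (4 tc²)` relations. Since `4 tc² ≤ 100 + 2 ^ tc + tc`
(`four_mul_sq_le`), this is within the bound up to the constant `2 ^ 100`. Every recorded value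
belongs to an actual set, so no false positive arises.

For the machine model, expressions `Ex` and commands `Cmd` have a denotational semantics, a compiler
and a polynomial cost. The theorems `runs_code` reduce all statements about steps to statements
about `eval` and `run`; only the loop over the relations is not polynomial, and `runs_forCode`
treats it directly. -/

namespace RAM

/-! ### Rules for bounding running times. -/

/-- Started in `s`, the program `p` halts within `C` steps in a state satisfying `P`. -/
def Runs (p : Program) (s : State) (C : ℕ) (P : State → Prop) : Prop :=
  ∃ t s', Exec p s t s' ∧ t ≤ C ∧ P s'

section Rules
variable {p q : Program} {s : State} {C D : ℕ} {P Q : State → Prop}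

theorem Runs.mono (h : Runs p s C P) (hC : C ≤ D) (hP : ∀ s', P s' → Q s') : Runs p s D Q := by
  obtain ⟨t, s', h, ht, hs⟩ := h
  exact ⟨t, s', h, ht.trans hC, hP _ hs⟩

theorem Runs.seq (h : Runs p s C P) (h' : ∀ s', P s' → Runs q s' D Q) :
    Runs (.seq p q) s (C + D) Q := by
  obtain ⟨t, s', h, ht, hs⟩ := h
  obtain ⟨t', s'', h', ht', hs'⟩ := h' s' hs
  exact ⟨t + t', s'', .seq h h', by omega, hs'⟩

theorem Runs.const {r c : ℕ} (h : P (s.setReg r c)) : Runs (.const r c) s 1 P :=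
  ⟨_, _, .const _ _ _, le_rfl, h⟩

theorem Runs.add {r a b : ℕ} (h : P (s.setReg r (s.reg a + s.reg b))) :
    Runs (.add r a b) s 1 P :=
  ⟨_, _, .add _ _ _ _, le_rfl, h⟩

theorem Runs.sub {r a b : ℕ} (h : P (s.setReg r (s.reg a - s.reg b))) :
    Runs (.sub r a b) s 1 P :=
  ⟨_, _, .sub _ _ _ _, le_rfl, h⟩

theorem Runs.load {r A a : ℕ} (h : P (s.setReg r (s.mem A (s.reg a)))) :
    Runs (.load r A a) s 1 P :=
  ⟨_, _, .load _ _ _ _, le_rfl, h⟩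

theorem Runs.store {r A a : ℕ} (h : P (s.setMem A (s.reg a) (s.reg r))) :
    Runs (.store A a r) s 1 P :=
  ⟨_, _, .store _ _ _ _, le_rfl, h⟩

theorem Runs.ite {r : ℕ} (h : s.reg r ≠ 0 → Runs p s C P) (h' : s.reg r = 0 → Runs q s D P) :
    Runs (.ite r p q) s (C + D + 1) P := by
  by_cases hr : s.reg r = 0
  · obtain ⟨t, s', h, ht, hs⟩ := h' hr
    exact ⟨_, s', .ite_false hr h, by omega, hs⟩
  · obtain ⟨t, s', h, ht, hs⟩ := h hr
    exact ⟨_, s', .ite_true hr h, by omega, hs⟩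

/-- A loop whose control register counts down, with an invariant indexed by that register. -/
theorem Runs.while {r : ℕ} (I : ℕ → State → Prop) (hr : ∀ j s, I j s → s.reg r = j)
    (hI : ∀ j s, I (j + 1) s → Runs p s C (I j)) :
    ∀ (j : ℕ) (s : State), I j s → Runs (.while r p) s (j * (C + 1) + 1) (I 0) := by
  intro j
  induction j with
  | zero => exact fun s hs => ⟨1, s, .while_false (hr _ _ hs), by omega, hs⟩
  | succ j ih =>
    intro s hs
    obtain ⟨t, s', h, ht, hs'⟩ := hI j s hs
    obtain ⟨t', s'', h', ht', hs''⟩ := ih s' hs'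
    have h0 : s.reg r ≠ 0 := by rw [hr _ _ hs]; omega
    refine ⟨_, s'', .while_true h0 h h', ?_, hs''⟩
    rw [add_one_mul]
    omega

end Rules

@[simp] theorem State.reg_setReg (s : State) (r v r' : ℕ) :
    (s.setReg r v).reg r' = if r' = r then v else s.reg r' := by
  simp [State.setReg, Function.update_apply]

@[simp] theorem State.mem_setReg (s : State) (r v : ℕ) : (s.setReg r v).mem = s.mem := rfl

@[simp] theorem State.reg_setMem (s : State) (A i v : ℕ) : (s.setMem A i v).reg = s.reg := rfl

theorem State.mem_setMem (s : State) (A i v B j : ℕ) :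
    (s.setMem A i v).mem B j = if B = A ∧ j = i then v else s.mem B j := by
  by_cases h : B = A
  · subst h; simp [State.setMem, Function.update_apply]
  · simp [State.setMem, h]

/-! ### Expressions and their compilation. -/

/-- Registers with smaller numbers are program variables, the others are scratch space. -/
def numVars : ℕ := 40

/-- Two states with the same program variables and arrays. -/
def Agree (s s' : State) : Prop := (∀ r < numVars, s.reg r = s'.reg r) ∧ s.mem = s'.mem

theorem Agree.setReg {s s' : State} (h : Agree s s') (r v : ℕ) :
    Agree (s.setReg r v) (s'.setReg r v) := by
  refine ⟨fun r' hr' => ?_, h.2⟩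
  simp [h.1 r' hr']

theorem Agree.setMem {s s' : State} (h : Agree s s') (A i v : ℕ) :
    Agree (s.setMem A i v) (s'.setMem A i v) := by
  refine ⟨h.1, ?_⟩
  simp [State.setMem, h.2]

/-- Expressions; `sum r e` sums `e` over the values of the variable `r` below register `0`. -/
inductive Ex where
  | lit (c : ℕ)
  | var (r : ℕ)
  | get (A : ℕ) (e : Ex)
  | add (a b : Ex)
  | sub (a b : Ex)
  | cond (c a b : Ex)
  | sum (r : ℕ) (e : Ex)

namespace Ex

/-- The value of an expression. -/
def eval : Ex → State → ℕ
  | lit c, _ => c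
  | var r, s => s.reg r
  | get A e, s => s.mem A (e.eval s)
  | add a b, s => a.eval s + b.eval s
  | sub a b, s => a.eval s - b.eval s
  | cond c a b, s => if c.eval s ≠ 0 then a.eval s else b.eval s
  | sum r e, s => ∑ i ∈ Finset.range (s.reg 0), e.eval (s.setReg r i)

/-- Only program variables occur, and register `0` is not bound. -/
def wf : Ex → Bool
  | lit _ => true
  | var r => decide (r < numVars)
  | get _ e => e.wf
  | add a b => a.wf && b.wf
  | sub a b => a.wf && b.wf
  | cond c a b => c.wf && (a.wf && b.wf)
  | sum r e => decide (r ≠ 0) && (decide (r < numVars) && e.wf)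

/-- A program that leaves the value in register `d`, using only registers from `d` on. -/
def code : Ex → ℕ → Program
  | lit c, d => .const d c
  | var r, d => .seq (.const d 0) (.add d d r)
  | get A e, d => .seq (e.code d) (.load d A d)
  | add a b, d => .seq (a.code d) (.seq (b.code (d + 1)) (.add d d (d + 1)))
  | sub a b, d => .seq (a.code d) (.seq (b.code (d + 1)) (.sub d d (d + 1)))
  | cond c a b, d => .seq (c.code d) (.ite d (a.code d) (b.code d))
  | sum r e, d =>
    .seq (.const d 0) <| .seq (.add (d + 2) d r) <| .seq (.const r 0) <| .seq (.add (d + 1) d 0) <|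
    .seq (.while (d + 1) (.seq (e.code (d + 3)) <| .seq (.add d d (d + 3)) <|
      .seq (.const (d + 3) 1) <| .seq (.add r r (d + 3)) (.sub (d + 1) (d + 1) (d + 3)))) <|
    .seq (.const r 0) (.add r r (d + 2))

/-- A bound for the number of steps of the compiled expression. -/
noncomputable def cost : Ex → Polynomial ℕ
  | lit _ => 1
  | var _ => 2
  | get _ e => e.cost + 1
  | add a b => a.cost + (b.cost + 1)
  | sub a b => a.cost + (b.cost + 1)
  | cond c a b => c.cost + (a.cost + b.cost + 1)
  | sum _ e => Polynomial.X * (e.cost + 5) + 7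

/-- Compiled code disturbs scratch registers; this shows that the disturbance is invisible to later
evaluations. -/
theorem eval_congr {e : Ex} (he : e.wf = true) :
    ∀ {s s' : State}, Agree s s' → e.eval s = e.eval s' := by
  induction e with
  | lit c => intros; rfl
  | var r => exact fun h => h.1 r (by simpa [wf] using he)
  | get A e ih => intro s s' h; simp [eval, ih he h, h.2]
  | add a b iha ihb =>
    intro s s' h
    simp only [wf, Bool.and_eq_true] at he
    simp [eval, iha he.1 h, ihb he.2 h]
  | sub a b iha ihb =>
    intro s s' h
    simp only [wf, Bool.and_eq_true] at he
    simp [eval, iha he.1 h, ihb he.2 h]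
  | cond c a b ihc iha ihb =>
    intro s s' h
    simp only [wf, Bool.and_eq_true] at he
    simp [eval, ihc he.1 h, iha he.2.1 h, ihb he.2.2 h]
  | sum r e ih =>
    intro s s' h
    simp only [wf, Bool.and_eq_true] at he
    simp only [eval, h.1 0 (by decide)]
    exact Finset.sum_congr rfl fun i _ => ih he.2.2 (h.setReg r i)

/-- Registers below `d` act as a stack: subexpressions are evaluated further up, so intermediate
results survive. A sum uses its bound variable as a real register, and so has to restore it. -/
theorem runs_code {e : Ex} (he : e.wf = true) : ∀ {d : ℕ} (_ : numVars ≤ d) (s : State),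
    Runs (e.code d) s (e.cost.eval (s.reg 0)) fun s' =>
      s'.reg d = e.eval s ∧ (∀ r < d, s'.reg r = s.reg r) ∧ s'.mem = s.mem := by
  induction e with
  | lit c =>
    intro d hd s
    simp only [cost, Polynomial.eval_one]
    refine Runs.const ⟨by simp [eval], fun r hr => by simp [hr.ne], rfl⟩
  | var r =>
    intro d hd s
    have hr : r < numVars := by simpa [wf] using he
    refine (Runs.seq (Runs.const (P := fun s' => s' = s.setReg d 0) rfl)
      (fun s' h => Runs.add (P := fun s' => s'.reg d = s.reg r ∧
        (∀ r < d, s'.reg r = s.reg r) ∧ s'.mem = s.mem) ?_)).mono ?_ (fun s' h => h)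
    · subst h
      refine ⟨by simp; omega, fun r hr => by simp [hr.ne], rfl⟩
    · simp [cost]
  | get A e ih =>
    intro d hd s
    refine (Runs.seq (ih he hd s) (fun s' h => Runs.load (P := fun s' =>
      s'.reg d = (get A e).eval s ∧ (∀ r < d, s'.reg r = s.reg r) ∧ s'.mem = s.mem) ?_)).mono ?_
      (fun s' h => h)
    · obtain ⟨h1, h2, h3⟩ := h
      exact ⟨by simp [eval, h1, h3], fun r hr => by simp [hr.ne, h2 r hr], h3⟩
    · simp [cost]
  | add a b iha ihb =>
    intro d hd s
    simp only [wf, Bool.and_eq_true] at he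
    refine (Runs.seq (iha he.1 hd s) (fun s' h => Runs.seq (ihb he.2 (d := d + 1) (by omega) s')
      (fun s'' h' => Runs.add (P := fun s' =>
      s'.reg d = (add a b).eval s ∧ (∀ r < d, s'.reg r = s.reg r) ∧ s'.mem = s.mem) ?_) |>.mono
      (D := b.cost.eval (s.reg 0) + 1) ?_ fun s' h => h)).mono ?_ (fun s' h => h)
    · obtain ⟨h1, h2, h3⟩ := h
      obtain ⟨h1', h2', h3'⟩ := h'
      have hb : b.eval s' = b.eval s :=
        eval_congr he.2 ⟨fun r hr => h2 r (by omega), h3⟩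
      exact ⟨by simp [eval, h1', h2' d (by omega), h1, hb],
        fun r hr => by simp [hr.ne, h2' r (by omega), h2 r hr], by simp [h3', h3]⟩
    · rw [h.2.1 0 (lt_of_lt_of_le (by decide) hd)]
    · simp [cost]
  | sub a b iha ihb =>
    intro d hd s
    simp only [wf, Bool.and_eq_true] at he
    refine (Runs.seq (iha he.1 hd s) (fun s' h => Runs.seq (ihb he.2 (d := d + 1) (by omega) s')
      (fun s'' h' => Runs.sub (P := fun s' =>
      s'.reg d = (sub a b).eval s ∧ (∀ r < d, s'.reg r = s.reg r) ∧ s'.mem = s.mem) ?_) |>.mono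
      (D := b.cost.eval (s.reg 0) + 1) ?_ fun s' h => h)).mono ?_ (fun s' h => h)
    · obtain ⟨h1, h2, h3⟩ := h
      obtain ⟨h1', h2', h3'⟩ := h'
      have hb : b.eval s' = b.eval s :=
        eval_congr he.2 ⟨fun r hr => h2 r (by omega), h3⟩
      exact ⟨by simp [eval, h1', h2' d (by omega), h1, hb],
        fun r hr => by simp [hr.ne, h2' r (by omega), h2 r hr], by simp [h3', h3]⟩
    · rw [h.2.1 0 (lt_of_lt_of_le (by decide) hd)]
    · simp [cost]
  | cond c a b ihc iha ihb =>
    intro d hd s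
    simp only [wf, Bool.and_eq_true] at he
    have key : ∀ {e : Ex} {s' : State}, e.wf = true → (∀ {d : ℕ} (_ : numVars ≤ d) (s : State),
        Runs (e.code d) s (e.cost.eval (s.reg 0)) fun s' =>
          s'.reg d = e.eval s ∧ (∀ r < d, s'.reg r = s.reg r) ∧ s'.mem = s.mem) →
        ((∀ r < d, s'.reg r = s.reg r) ∧ s'.mem = s.mem) →
        Runs (e.code d) s' (e.cost.eval (s.reg 0)) fun s' =>
          s'.reg d = e.eval s ∧ (∀ r < d, s'.reg r = s.reg r) ∧ s'.mem = s.mem := by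
      intro e s' he ih h
      refine (ih hd s').mono (by rw [h.1 0 (lt_of_lt_of_le (by decide) hd)]) fun s'' h' =>
        ⟨?_, fun r hr => by rw [h'.2.1 r hr, h.1 r hr], by rw [h'.2.2, h.2]⟩
      rw [h'.1]
      exact eval_congr he ⟨fun r hr => h.1 r (by omega), h.2⟩
    refine (Runs.seq (ihc he.1 hd s) (fun s' h => Runs.ite
      (fun hc => (key (s' := s') he.2.1 (iha he.2.1) h.2).mono le_rfl
        (Q := fun s' => s'.reg d = (cond c a b).eval s ∧
          (∀ r < d, s'.reg r = s.reg r) ∧ s'.mem = s.mem) fun s'' h' => ?_)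
      (fun hc => (key (s' := s') he.2.2 (ihb he.2.2) h.2).mono le_rfl
        fun s'' h' => ?_))).mono ?_ (fun s' h => h)
    · rw [h.1] at hc
      exact ⟨by simp [eval, hc, h'.1], h'.2⟩
    · rw [h.1] at hc
      exact ⟨by simp [eval, hc, h'.1], h'.2⟩
    · simp [cost]
  | sum r e ih =>
    intro d hd s
    simp only [wf, Bool.and_eq_true, decide_eq_true_eq] at he
    obtain ⟨hr0, hrK, he⟩ := he
    have hr : r < d := by omega
    have h0 : 0 < d := lt_of_lt_of_le (by decide) hd
    set n := s.reg 0 with hn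
    -- Here `j` counts the rounds still to come, so `n - j` terms have been added; register `d + 2`
    -- keeps the old value of the bound variable.
    let I : ℕ → State → Prop := fun j s' => s'.reg (d + 1) = j ∧ j ≤ n ∧
      s'.reg d = ∑ i ∈ Finset.range (n - j), e.eval (s.setReg r i) ∧ s'.reg r = n - j ∧
      s'.reg (d + 2) = s.reg r ∧ (∀ r' < d, r' ≠ r → s'.reg r' = s.reg r') ∧ s'.mem = s.mem
    have hI : ∀ j s', I (j + 1) s' → Runs (.seq (e.code (d + 3)) <| .seq (.add d d (d + 3)) <|
        .seq (.const (d + 3) 1) <| .seq (.add r r (d + 3)) (.sub (d + 1) (d + 1) (d + 3))) s'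
        (e.cost.eval n + (1 + (1 + (1 + 1)))) (I j) := by
      intro j s' h
      obtain ⟨h1, h2, h3, h4, h5, h6, h7⟩ := h
      have e0 : s'.reg 0 = n := h6 0 h0 hr0.symm
      have := ih he (d := d + 3) (by omega) s'
      rw [e0] at this
      refine this.seq fun s₁ g => Runs.seq (Runs.add (P := fun s₂ =>
        s₂ = s₁.setReg d (s₁.reg d + s₁.reg (d + 3))) rfl) fun s₂ g₂ =>
        Runs.seq (Runs.const (P := fun s₃ => s₃ = s₂.setReg (d + 3) 1) rfl) fun s₃ g₃ =>
        Runs.seq (Runs.add (P := fun s₄ => s₄ = s₃.setReg r (s₃.reg r + s₃.reg (d + 3))) rfl)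
          fun s₄ g₄ => Runs.sub ?_
      subst g₄ g₃ g₂
      obtain ⟨g1, g2, g3⟩ := g
      have ev : e.eval s' = e.eval (s.setReg r (n - (j + 1))) := by
        refine eval_congr he ⟨fun r' hr' => ?_, by simp [h7]⟩
        by_cases hrr : r' = r
        · simp [hrr, h4]
        · simp [hrr, h6 r' (by omega) hrr]
      have hnj : n - j = n - (j + 1) + 1 := by omega
      refine ⟨?_, by omega, ?_, ?_, ?_, ?_, by simp [g3, h7]⟩
      · simp [g2 (d + 1) (by omega), h1, show d + 1 ≠ r by omega, show d + 3 ≠ r by omega]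
      · rw [hnj, Finset.sum_range_succ, ← ev, ← g1, ← h3]
        simp [g2 d (by omega), show d ≠ r by omega]
      · simp [hr.ne, g2 r (by omega), h4, show r ≠ d + 1 by omega, show r ≠ d + 3 by omega]
        omega
      · simp [g2 (d + 2) (by omega), h5, show d + 2 ≠ r by omega]
      · intro r' hr' hne
        simp [hne, hr'.ne, g2 r' (by omega), h6 r' hr' hne, show r' ≠ d + 1 by omega,
          show r' ≠ d + 3 by omega]
    refine (Runs.seq (Runs.const (P := fun s₁ => s₁ = s.setReg d 0) rfl) fun s₁ g₁ =>
      Runs.seq (Runs.add (P := fun s₂ => s₂ = s₁.setReg (d + 2) (s₁.reg d + s₁.reg r)) rfl)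
        fun s₂ g₂ =>
      Runs.seq (Runs.const (P := fun s₃ => s₃ = s₂.setReg r 0) rfl) fun s₃ g₃ =>
      Runs.seq (Runs.add (P := fun s₄ => s₄ = s₃.setReg (d + 1) (s₃.reg d + s₃.reg 0)) rfl)
        fun s₄ g₄ =>
      Runs.seq (Runs.while (r := d + 1) I (fun j s h => h.1) hI n s₄ ?_) fun s₅ g₅ =>
      Runs.seq (Runs.const (P := fun s₆ => s₆ = s₅.setReg r 0) rfl) fun s₆ g₆ =>
      Runs.add (P := fun s' => s'.reg d = (sum r e).eval s ∧ (∀ r < d, s'.reg r = s.reg r) ∧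
        s'.mem = s.mem) ?_).mono ?_ (fun s' h => h)
    · subst g₄ g₃ g₂ g₁
      refine ⟨?_, le_rfl, ?_, ?_, ?_, ?_, rfl⟩
      · simp [hr.ne', h0.ne, hr0.symm, hn]
      · simp [show d ≠ r by omega]
      · simp [show r ≠ d + 1 by omega]
      · simp [show d + 2 ≠ r by omega, hr.ne]
      · intro r' hr' hne
        simp [hne, hr'.ne, show r' ≠ d + 1 by omega, show r' ≠ d + 2 by omega]
    · subst g₆
      obtain ⟨-, -, h3, -, h5, h6, h7⟩ := g₅
      refine ⟨?_, ?_, ?_⟩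
      · simp [show d ≠ r by omega, h3, eval, hn]
      · intro r' hr'
        by_cases hrr : r' = r
        · simp [hrr, h5, show d + 2 ≠ r by omega]
        · simp [hrr, h6 r' hr' hrr]
      · simpa using h7
    · simp only [cost, Polynomial.eval_add, Polynomial.eval_mul, Polynomial.eval_X,
        Polynomial.eval_ofNat]
      rw [show Polynomial.eval n e.cost + (1 + (1 + (1 + 1))) + 1 = Polynomial.eval n e.cost + 5 by
        omega]
      omega

end Ex

/-! ### Counting loops, commands and their compilation. -/

/-- Iterate `f`, which is told the number of the current round, for `k` rounds. -/
def forRun (f : ℕ → State → State) (k : ℕ) (s : State) : State :=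
  Nat.rec s (fun i s => f i s) k

theorem forRun_induction {f : ℕ → State → State} {n : ℕ} {s : State} (P : ℕ → State → Prop)
    (h0 : P 0 s) (hs : ∀ i < n, ∀ s, P i s → P (i + 1) (f i s)) : P n (forRun f n s) := by
  have : ∀ k ≤ n, P k (forRun f k s) := by
    intro k
    induction k with
    | zero => exact fun _ => h0
    | succ k ih => exact fun hk => hs k hk _ (ih (by omega))
  exact this n le_rfl

/-- For `r` from `0` to the value of register `b`, exclusively, do `p`; the registers `d` and
`d + 1` are used for counting. -/
def forCode (r b : ℕ) (p : Program) (d : ℕ) : Program :=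
  .seq (.const d 0) <| .seq (.add (d + 1) d b) <| .while (d + 1) <|
    .seq (.const r 0) <| .seq (.add r r d) <| .seq p <| .seq (.const (d + 2) 1) <|
      .seq (.add d d (d + 2)) (.sub (d + 1) (d + 1) (d + 2))

/-- The bound is copied once, before the loop, so the number of rounds is the initial value of
register `b`. That value may be exponential in `n`; this rule serves both the loops of `Cmd` and the
loop over all guesses. -/
theorem runs_forCode {r b d n C : ℕ} {p : Program} {f : State → State} (hd : numVars ≤ d)
    (hr : r < numVars) (hr0 : r ≠ 0) (hb : b < numVars)
    (hf : ∀ s, (f s).reg 0 = s.reg 0)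
    (hp : ∀ s σ, s.reg 0 = n → Agree s σ → Runs p s C fun s' =>
      Agree s' (f σ) ∧ ∀ i, numVars ≤ i → i < d + 2 → s'.reg i = s.reg i)
    {s σ : State} (hn : s.reg 0 = n) (hs : Agree s σ) :
    Runs (forCode r b p d) s (s.reg b * (C + 6) + 3) fun s' =>
      Agree s' (forRun (fun i s => f (s.setReg r i)) (s.reg b) σ) ∧
        ∀ i, numVars ≤ i → i < d → s'.reg i = s.reg i := by
  have hK : 0 < numVars := by decide
  set m := s.reg b with hm
  let F := fun j => forRun (fun i s => f (s.setReg r i)) j σ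
  have hF0 : ∀ j, (F j).reg 0 = n := by
    intro j
    induction j with
    | zero => rw [← hn]; exact (hs.1 0 hK).symm
    | succ j ih =>
      refine (hf _).trans ?_
      simp only [State.reg_setReg, if_neg hr0.symm]
      exact ih
  let I : ℕ → State → Prop := fun j s' => s'.reg (d + 1) = j ∧ j ≤ m ∧ s'.reg d = m - j ∧
    Agree s' (F (m - j)) ∧ ∀ i, numVars ≤ i → i < d → s'.reg i = s.reg i
  have hI : ∀ j s', I (j + 1) s' → Runs (.seq (.const r 0) <| .seq (.add r r d) <| .seq p <|
      .seq (.const (d + 2) 1) <| .seq (.add d d (d + 2)) (.sub (d + 1) (d + 1) (d + 2))) s'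
      (1 + (1 + (C + (1 + (1 + 1))))) (I j) := by
    intro j s' ⟨h1, h2, h3, h4, h5⟩
    refine Runs.seq (Runs.const (P := fun s₁ => s₁ = s'.setReg r 0) rfl) fun s₁ g₁ =>
      Runs.seq (Runs.add (P := fun s₂ => s₂ = s₁.setReg r (s₁.reg r + s₁.reg d)) rfl)
        fun s₂ g₂ => ?_
    have e2 : s₂ = s'.setReg r (m - (j + 1)) := by
      subst g₂ g₁
      ext i
      · by_cases hi : i = r
        · simp [hi, h3, show d ≠ r by omega]
        · simp [hi]
      · rfl
    have a2 : Agree s₂ ((F (m - (j + 1))).setReg r (m - (j + 1))) := e2 ▸ h4.setReg _ _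
    have n2 : s₂.reg 0 = n := by
      rw [a2.1 0 hK]; simpa [hr0.symm] using hF0 _
    refine (hp s₂ _ n2 a2).seq fun s₃ g₃ =>
      Runs.seq (Runs.const (P := fun s₄ => s₄ = s₃.setReg (d + 2) 1) rfl) fun s₄ g₄ =>
      Runs.seq (Runs.add (P := fun s₅ => s₅ = s₄.setReg d (s₄.reg d + s₄.reg (d + 2))) rfl)
        fun s₅ g₅ => Runs.sub ?_
    subst g₅ g₄ e2
    obtain ⟨g1, g2⟩ := g₃
    have hmj : m - j = m - (j + 1) + 1 := by omega
    refine ⟨?_, by omega, ?_, ⟨?_, ?_⟩, ?_⟩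
    · simp [g2 (d + 1) (by omega) (by omega), h1, show d + 1 ≠ r by omega]
    · simp [g2 d (by omega) (by omega), h3, show d ≠ r by omega]
      omega
    · intro i hi
      simp only [State.reg_setReg, if_neg (show i ≠ d + 1 by omega), if_neg (show i ≠ d by omega),
        if_neg (show i ≠ d + 2 by omega), hmj]
      exact g1.1 i hi
    · rw [hmj]
      exact g1.2
    · intro i hi hid
      simp [show i ≠ d + 1 by omega, show i ≠ d by omega, show i ≠ d + 2 by omega,
        g2 i hi (by omega), show i ≠ r by omega, h5 i hi hid]
  refine (Runs.seq (Runs.const (P := fun s₁ => s₁ = s.setReg d 0) rfl) fun s₁ g₁ =>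
    Runs.seq (Runs.add (P := fun s₂ => s₂ = s₁.setReg (d + 1) (s₁.reg d + s₁.reg b)) rfl)
      fun s₂ g₂ => Runs.while (r := d + 1) I (fun j s h => h.1) hI m s₂ ?_).mono ?_ fun s' g => ?_
  · subst g₂ g₁
    refine ⟨?_, le_rfl, ?_, ⟨?_, ?_⟩, ?_⟩
    · simp [show b ≠ d by omega, hm]
    · simp
    · intro i hi
      simp only [State.reg_setReg, if_neg (show i ≠ d + 1 by omega), if_neg (show i ≠ d by omega),
        Nat.sub_self]
      exact hs.1 i hi
    · rw [Nat.sub_self]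
      exact hs.2
    · intro i hi hid
      simp [show i ≠ d + 1 by omega, hid.ne]
  · rw [show 1 + (1 + (C + (1 + (1 + 1)))) + 1 = C + 6 by omega]
    omega
  · exact ⟨g.2.2.2.1, g.2.2.2.2⟩

/-- Commands; `loop r c` does `c` for the values of `r` below register `0`. -/
inductive Cmd where
  | set (r : ℕ) (e : Ex)
  | put (A : ℕ) (a e : Ex)
  | seq (c c' : Cmd)
  | cond (e : Ex) (c c' : Cmd)
  | loop (r : ℕ) (c : Cmd)

namespace Cmd

/-- The effect of a command. -/
def run : Cmd → State → State
  | set r e, s => s.setReg r (e.eval s)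
  | put A a e, s => s.setMem A (a.eval s) (e.eval s)
  | seq c c', s => c'.run (c.run s)
  | cond e c c', s => if e.eval s ≠ 0 then c.run s else c'.run s
  | loop r c, s => forRun (fun i s => c.run (s.setReg r i)) (s.reg 0) s

/-- Only program variables occur, and register `0` is not changed. -/
def wf : Cmd → Bool
  | set r e => decide (r ≠ 0) && (decide (r < numVars) && e.wf)
  | put _ a e => a.wf && e.wf
  | seq c c' => c.wf && c'.wf
  | cond e c c' => e.wf && (c.wf && c'.wf)
  | loop r c => decide (r ≠ 0) && (decide (r < numVars) && c.wf)

/-- Compiled commands. -/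
def code : Cmd → ℕ → Program
  | set r e, d => .seq (e.code d) (.seq (.const r 0) (.add r r d))
  | put A a e, d => .seq (a.code d) (.seq (e.code (d + 1)) (.store A d (d + 1)))
  | seq c c', d => .seq (c.code d) (c'.code d)
  | cond e c c', d => .seq (e.code d) (.ite d (c.code d) (c'.code d))
  | loop r c, d => forCode r 0 (c.code (d + 2)) d

/-- A bound for the number of steps of the compiled command. -/
noncomputable def cost : Cmd → Polynomial ℕ
  | set _ e => e.cost + 2
  | put _ a e => a.cost + (e.cost + 1)
  | seq c c' => c.cost + c'.cost
  | cond e c c' => e.cost + (c.cost + c'.cost + 1)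
  | loop _ c => Polynomial.X * (c.cost + 6) + 3

/-- The registers that a command may change. -/
def regs : Cmd → List ℕ
  | set r _ => [r]
  | put _ _ _ => []
  | seq c c' => c.regs ++ c'.regs
  | cond _ c c' => c.regs ++ c'.regs
  | loop r c => r :: c.regs

/-- The arrays that a command may change. -/
def arrs : Cmd → List ℕ
  | set _ _ => []
  | put A _ _ => [A]
  | seq c c' => c.arrs ++ c'.arrs
  | cond _ c c' => c.arrs ++ c'.arrs
  | loop _ c => c.arrs

/-- A frame rule: for a concrete command the hypothesis is settled by `decide`. `mem_run` does the
same for arrays. -/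
theorem reg_run {r : ℕ} {c : Cmd} (h : r ∉ c.regs) : ∀ s, (c.run s).reg r = s.reg r := by
  induction c with
  | set r' e => intro s; simp [regs] at h; simp [run, h]
  | put A a e => intro s; rfl
  | seq c c' ih ih' =>
    intro s; simp [regs] at h; simp [run, ih h.1, ih' h.2]
  | cond e c c' ih ih' =>
    intro s; simp [regs] at h; simp only [run]; split_ifs <;> simp [ih h.1, ih' h.2]
  | loop r' c ih =>
    intro s
    simp [regs] at h
    exact forRun_induction (fun _ s' => s'.reg r = s.reg r) rfl
      fun i _ s' hs' => by simp [ih h.2, h.1, hs']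

theorem mem_run {A : ℕ} {c : Cmd} (h : A ∉ c.arrs) : ∀ s, (c.run s).mem A = s.mem A := by
  induction c with
  | set r' e => intro s; rfl
  | put B a e => intro s; simp [arrs] at h; ext i; simp [run, State.mem_setMem, h]
  | seq c c' ih ih' =>
    intro s; simp [arrs] at h; simp [run, ih h.1, ih' h.2]
  | cond e c c' ih ih' =>
    intro s; simp [arrs] at h; simp only [run]; split_ifs <;> simp [ih h.1, ih' h.2]
  | loop r' c ih =>
    intro s
    exact forRun_induction (fun _ s' => s'.mem A = s.mem A) rfl
      fun i _ s' hs' => by simp [ih h, hs']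

theorem zero_notMem_regs {c : Cmd} (h : c.wf = true) : 0 ∉ c.regs := by
  induction c with
  | set r e => simp [wf] at h; simpa [regs] using Ne.symm h.1
  | put A a e => simp [regs]
  | seq c c' ih ih' => simp [wf] at h; simp [regs, ih h.1, ih' h.2]
  | cond e c c' ih ih' => simp [wf] at h; simp [regs, ih h.2.1, ih' h.2.2]
  | loop r c ih => simp [wf] at h; simpa [regs, ih h.2.2] using Ne.symm h.1

/-- A simulation up to `Agree`: the actual state `s` differs from the ideal state `σ` only in
scratch registers. Those below `d` are kept because they may hold the counters of enclosing loops.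
-/
theorem runs_code {c : Cmd} (hc : c.wf = true) : ∀ {d : ℕ} (_ : numVars ≤ d) {s σ : State}
    (_ : Agree s σ), Runs (c.code d) s (c.cost.eval (s.reg 0)) fun s' =>
      Agree s' (c.run σ) ∧ ∀ i, numVars ≤ i → i < d → s'.reg i = s.reg i := by
  have hK : 0 < numVars := by decide
  induction c with
  | set r e =>
    intro d hd s σ h
    simp only [wf, Bool.and_eq_true, decide_eq_true_eq] at hc
    obtain ⟨hr0, hr, he⟩ := hc
    refine ((Ex.runs_code he hd s).seq fun s₁ g₁ =>
      Runs.seq (Runs.const (P := fun s₂ => s₂ = s₁.setReg r 0) rfl) fun s₂ g₂ =>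
        Runs.add (P := fun s' => Agree s' ((set r e).run σ) ∧
          ∀ i, numVars ≤ i → i < d → s'.reg i = s.reg i) ?_).mono
      (by simp [cost]) fun s' h => h
    subst g₂
    obtain ⟨g1, g2, g3⟩ := g₁
    refine ⟨⟨fun i hi => ?_, ?_⟩, fun i hi hid => ?_⟩
    · by_cases hir : i = r
      · simp [hir, run, show d ≠ r by omega, g1, Ex.eval_congr he h]
      · simp [hir, run, g2 i (by omega), h.1 i hi]
    · simp [run, g3, h.2]
    · simp [show i ≠ r by omega, g2 i hid]
  | put A a e =>
    intro d hd s σ h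
    simp only [wf, Bool.and_eq_true] at hc
    refine ((Ex.runs_code hc.1 hd s).seq fun s₁ g₁ =>
      (Runs.seq (Ex.runs_code hc.2 (d := d + 1) (by omega) s₁) fun s₂ g₂ =>
        Runs.store (P := fun s' => Agree s' ((put A a e).run σ) ∧
          ∀ i, numVars ≤ i → i < d → s'.reg i = s.reg i) ?_).mono
            (D := e.cost.eval (s.reg 0) + 1) ?_ fun s' h => h).mono
      (by simp [cost]) fun s' h => h
    · obtain ⟨g1, g2, g3⟩ := g₁
      obtain ⟨g1', g2', g3'⟩ := g₂
      have e1 : s₂.reg d = a.eval σ := by rw [g2' d (by omega), g1, Ex.eval_congr hc.1 h]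
      have e2 : s₂.reg (d + 1) = e.eval σ := by
        rw [g1', ← Ex.eval_congr hc.2 h]
        exact Ex.eval_congr hc.2 ⟨fun i hi => g2 i (by omega), g3⟩
      have a2 : Agree s₂ σ := ⟨fun i hi => by
        rw [g2' i (by omega), g2 i (by omega), h.1 i hi], by rw [g3', g3, h.2]⟩
      rw [e1, e2]
      exact ⟨a2.setMem _ _ _, fun i hi hid => by
        simp [g2' i (by omega), g2 i (by omega)]⟩
    · rw [g₁.2.1 0 (by omega)]
  | seq c c' ih ih' =>
    intro d hd s σ h
    simp only [wf, Bool.and_eq_true] at hc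
    refine ((ih hc.1 hd h).seq fun s₁ g₁ => (ih' hc.2 hd g₁.1).mono (D := c'.cost.eval (s.reg 0))
      (le_of_eq ?_) fun s' g => ⟨g.1, fun i hi hid => by rw [g.2 i hi hid, g₁.2 i hi hid]⟩).mono
      (by simp [cost]) fun s' h => h
    rw [g₁.1.1 0 hK, reg_run (zero_notMem_regs hc.1), h.1 0 hK]
  | cond e c c' ih ih' =>
    intro d hd s σ h
    simp only [wf, Bool.and_eq_true] at hc
    refine ((Ex.runs_code hc.1 hd s).seq fun s₁ g₁ => Runs.ite
      (C := c.cost.eval (s.reg 0)) (D := c'.cost.eval (s.reg 0)) (P := fun s' =>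
        Agree s' ((cond e c c').run σ) ∧ ∀ i, numVars ≤ i → i < d → s'.reg i = s.reg i)
      (fun hr => ?_) fun hr => ?_).mono (by simp [cost]) fun s' h => h
    all_goals
      obtain ⟨g1, g2, g3⟩ := g₁
      rw [g1, Ex.eval_congr hc.1 h] at hr
      have a1 : Agree s₁ σ := ⟨fun i hi => by rw [g2 i (by omega), h.1 i hi], by rw [g3, h.2]⟩
      simp only [run, hr, ne_eq, not_true_eq_false, not_false_eq_true, if_true, if_false]
    · refine (ih hc.2.1 hd a1).mono (by rw [g2 0 (by omega)]) fun s' g =>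
        ⟨g.1, fun i hi hid => by rw [g.2 i hi hid, g2 i hid]⟩
    · refine (ih' hc.2.2 hd a1).mono (by rw [g2 0 (by omega)]) fun s' g =>
        ⟨g.1, fun i hi hid => by rw [g.2 i hi hid, g2 i hid]⟩
  | loop r c ih =>
    intro d hd s σ h
    simp only [wf, Bool.and_eq_true, decide_eq_true_eq] at hc
    have := runs_forCode (p := c.code (d + 2)) (f := c.run) (n := s.reg 0)
      (C := c.cost.eval (s.reg 0)) hd hc.2.1 hc.1 hK (reg_run (zero_notMem_regs hc.2.2))
      (fun s₁ σ₁ h₁ h₁' => h₁ ▸ ih hc.2.2 (by omega) h₁') rfl h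
    refine this.mono (by simp [cost]) fun s' g => ⟨?_, g.2⟩
    rw [h.1 0 hK] at g
    exact g.1

end Cmd
end RAM

/-! ### Cut sizes under exchange of vertices, and the optimality of greedy enlargement. -/

open scoped Classical in
/-- The number of neighbours of `v` in `A`. -/
noncomputable def SimpleGraph.degIn {V : Type*} (G : SimpleGraph V) (v : V) (A : Finset V) : ℕ :=
  (A.filter (G.Adj v)).card

open scoped Classical in
/-- The size of the cut of a finite vertex set as a sum over ordered pairs. -/
noncomputable def SimpleGraph.cutSum {V : Type*} [Fintype V] (G : SimpleGraph V) (A : Finset V) :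
    ℕ :=
  ∑ u, ∑ v, if u ∈ A ∧ v ∉ A ∧ G.Adj u v then 1 else 0

/-- The vertices `v` and `w` have the same neighbours in `X`. -/
def SimpleGraph.SameType {V : Type*} (G : SimpleGraph V) (X : Finset V) (v w : V) : Prop :=
  ∀ x ∈ X, G.Adj v x ↔ G.Adj w x

namespace SimpleGraph

variable {V : Type*} {G : SimpleGraph V}

open scoped Classical in
theorem cutSize_eq_cutSum [Fintype V] (A : Finset V) : G.cutSize (A : Set V) = G.cutSum A := by
  have h : {e ∈ G.edgeSet | ∃ u ∈ (A : Set V), ∃ v ∉ (A : Set V), e = s(u, v)} =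
      (fun p : V × V => s(p.1, p.2)) ''
        ((Finset.univ.filter fun p : V × V => p.1 ∈ A ∧ p.2 ∉ A ∧ G.Adj p.1 p.2 : Finset _) :
          Set (V × V)) := by
    ext e
    simp only [Set.mem_ofPred_eq, Set.mem_image, Finset.coe_filter, Finset.mem_univ, true_and,
      Finset.mem_coe, Prod.exists]
    constructor
    · rintro ⟨he, u, hu, v, hv, rfl⟩
      exact ⟨u, v, ⟨hu, hv, he⟩, rfl⟩
    · rintro ⟨u, v, ⟨hu, hv, he⟩, rfl⟩
      exact ⟨he, u, hu, v, hv, rfl⟩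
  rw [cutSize, h, Set.InjOn.ncard_image, Set.ncard_coe_finset, Finset.card_filter,
    Fintype.sum_prod_type, cutSum]
  rintro ⟨u, v⟩ hp ⟨u', v'⟩ hp' he
  simp only [Finset.coe_filter, Set.mem_ofPred_eq] at hp hp'
  rcases Sym2.eq_iff.1 he with ⟨rfl, rfl⟩ | ⟨rfl, rfl⟩
  · rfl
  · exact absurd hp.2.1 hp'.2.2.1

theorem degIn_mono {v : V} {A B : Finset V} (h : ∀ w ∈ A, G.Adj v w → w ∈ B) :
    G.degIn v A ≤ G.degIn v B := by
  classical
  exact Finset.card_le_card fun w hw => by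
    simp only [Finset.mem_filter] at hw ⊢; exact ⟨h w hw.1 hw.2, hw.2⟩

theorem degIn_congr {v w : V} {A B : Finset V}
    (h : ∀ x, x ∈ A ∧ G.Adj v x ↔ x ∈ B ∧ G.Adj w x) : G.degIn v A = G.degIn w B := by
  classical
  refine congrArg Finset.card (Finset.ext fun x => ?_)
  simpa using h x

/-- Moving `v` into `A` adds its edges leaving `A` to the cut and removes its edges into `A`. The
equation is arranged to avoid subtraction. -/
theorem cutSum_insert [Fintype V] [DecidableEq V] {v : V} {A : Finset V} (hv : v ∉ A) :
    G.cutSum (insert v A) + 2 * G.degIn v A = G.cutSum A + G.degIn v Finset.univ := by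
  classical
  -- With indicator functions the cut is a bilinear expression, which is expanded in `a + e`, the
  -- indicator of `insert v A`.
  let g : V → V → ℤ := fun u w => if G.Adj u w then 1 else 0
  let a : V → ℤ := fun u => if u ∈ A then 1 else 0
  let e : V → ℤ := fun u => if u = v then 1 else 0
  have hg : ∀ u w, g u w = g w u := fun u w => by simp only [g, G.adj_comm]
  have h1 : (G.cutSum (insert v A) : ℤ) = ∑ u, ∑ w, g u w * (a u + e u) * (1 - a w - e w) := by
    simp only [cutSum]
    push_cast
    refine Finset.sum_congr rfl fun u _ => Finset.sum_congr rfl fun w _ => ?_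
    simp only [Finset.mem_insert, g, a, e]
    by_cases h1 : u = v <;> by_cases h2 : w = v <;> by_cases h3 : u ∈ A <;> by_cases h4 : w ∈ A <;>
      by_cases h5 : G.Adj u w <;> simp_all
  have h2 : (G.cutSum A : ℤ) = ∑ u, ∑ w, g u w * a u * (1 - a w) := by
    simp only [cutSum]
    push_cast
    refine Finset.sum_congr rfl fun u _ => Finset.sum_congr rfl fun w _ => ?_
    simp only [g, a]
    by_cases h3 : u ∈ A <;> by_cases h4 : w ∈ A <;> by_cases h5 : G.Adj u w <;> simp_all
  have h3 : (G.degIn v A : ℤ) = ∑ w, g v w * a w := by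
    simp only [degIn, Finset.card_filter]
    push_cast
    have := Finset.sum_ite_mem Finset.univ A fun w => g v w
    rw [Finset.univ_inter] at this
    refine this.symm.trans (Finset.sum_congr rfl fun w _ => ?_)
    simp only [a, mul_ite, mul_one, mul_zero]
  have h4 : (G.degIn v Finset.univ : ℤ) = ∑ w, g v w := by
    simp only [degIn, Finset.card_filter]
    push_cast
    rfl
  have h5 : ∑ u, ∑ w, g u w * (a u + e u) * (1 - a w - e w) =
      ∑ u, ∑ w, g u w * a u * (1 - a w) + ∑ u, e u * ∑ w, g u w * (1 - a w) -
        ∑ u, a u * ∑ w, g u w * e w - ∑ u, e u * ∑ w, g u w * e w := by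
    simp only [Finset.mul_sum, ← Finset.sum_add_distrib, ← Finset.sum_sub_distrib]
    refine Finset.sum_congr rfl fun u _ => Finset.sum_congr rfl fun w _ => ?_
    ring
  have h6 : ∀ f : V → ℤ, ∑ u, e u * f u = f v := fun f => by simp [e]
  have h7 : ∀ u, ∑ w, g u w * e w = g u v := fun u => by simp [e]
  have h8 : ∑ u, a u * g u v = ∑ w, g v w * a w :=
    Finset.sum_congr rfl fun w _ => by rw [hg, mul_comm]
  have h9 : g v v = 0 := by simp [g]
  zify
  rw [h1, h5, h2, h3, h4, h6, h6]
  simp only [h7, h8, h9, mul_sub, mul_one, Finset.sum_sub_distrib]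
  ring

theorem cutSum_erase [Fintype V] [DecidableEq V] {u : V} {A : Finset V} (hu : u ∈ A) :
    G.cutSum A + 2 * G.degIn u A = G.cutSum (A.erase u) + G.degIn u Finset.univ := by
  have h := G.cutSum_insert (A.notMem_erase u)
  rw [Finset.insert_erase hu] at h
  rw [← h]
  congr 2
  refine degIn_congr fun x => ?_
  simp only [Finset.mem_erase]
  refine ⟨fun hx => ⟨⟨?_, hx.1⟩, hx.2⟩, fun hx => ⟨hx.1.2, hx.2⟩⟩
  rintro rfl
  exact G.loopless.irrefl _ hx.2

theorem TrueTwins.adj_iff {u v : V} (h : G.TrueTwins u v) {w : V} (hu : w ≠ u) (hv : w ≠ v) :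
    G.Adj u w ↔ G.Adj v w := by
  have := Set.ext_iff.1 h.2 w
  simpa [hu, hv] using this

/-- The transposition of the twins is a bijection between the two neighbourhoods in `A`; the
hypothesis on `A` makes `A` invariant under it. -/
theorem TrueTwins.degIn_eq [DecidableEq V] {u v : V} (h : G.TrueTwins u v) (A : Finset V)
    (hA : u ∈ A ↔ v ∈ A) : G.degIn u A = G.degIn v A := by
  classical
  refine Finset.card_bij' (fun w _ => Equiv.swap u v w) (fun w _ => Equiv.swap u v w) ?_ ?_ ?_ ?_
  all_goals
    intro w hw
    simp only [Finset.mem_filter, Equiv.swap_apply_def, Equiv.swap_swap,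
      Equiv.swap_apply_self] at hw ⊢
  all_goals
    have h1 := h.1
    have h2 := h.1.symm
    have h3 : ∀ w, w ≠ u → w ≠ v → (G.Adj u w ↔ G.Adj v w) := fun w => h.adj_iff
    have h4 : ∀ w, ¬ G.Adj w w := fun w => G.loopless.irrefl w
    grind

theorem IsTwinCover.trueTwins {X : Finset V} (hX : G.IsTwinCover X) {u v : V} (hu : u ∉ X)
    (hv : v ∉ X) (h : G.Adj u v) : G.TrueTwins u v := by
  have := hX u v h
  tauto

theorem TrueTwins.sameType {X : Finset V} {u v : V} (h : G.TrueTwins u v) (hu : u ∉ X)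
    (hv : v ∉ X) : G.SameType X u v :=
  fun _ hx => h.adj_iff (fun e => hu (e ▸ hx)) (fun e => hv (e ▸ hx))

/-- Let `A` arise from `A₀` by adding vertices outside `X` as long as this increases the cut, and
let `R` be the set of vertices of `A₀` outside `X`. Then the cut of `A` is at least that of every
set `S` that has the same trace on `X` and attaches to `A₀`, provided that `S` contains each
vertex of `R` or some vertex of the same type and of at most the same degree. -/
theorem cutSum_le_of_greedy [Fintype V] [DecidableEq V] {X A A₀ R : Finset V} (hX : G.IsTwinCover X) (hRA : R ⊆ A)
    (hRX : ∀ r ∈ R, r ∉ X) (hR : ∀ r ∈ R, ∀ r' ∈ R, G.SameType X r r' → r = r')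
    (h1 : ∀ v ∈ A, v ∉ X → v ∉ R → 2 * G.degIn v A < G.degIn v Finset.univ)
    (h2 : ∀ v ∉ A, v ∉ X → (∃ a ∈ A₀, G.Adj v a) → G.degIn v Finset.univ ≤ 2 * G.degIn v A)
    {S : Finset V} (hSX : ∀ x ∈ X, x ∈ S ↔ x ∈ A)
    (hS : ∀ u ∈ S, u ∉ A → u ∉ X → ∃ a ∈ A₀, G.Adj u a)
    (hSR : ∀ r ∈ R, r ∈ S ∨ ∃ w ∈ S, w ∉ X ∧ G.SameType X r w ∧
      G.degIn w Finset.univ ≤ G.degIn r Finset.univ) :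
    G.cutSum S ≤ G.cutSum A := by
  generalize hD : symmDiff S A = D
  induction D using Finset.strongInduction generalizing S with
  | H D ih =>
    subst hD
    -- `S` is transformed into `A` without decreasing the cut: any `S'` strictly closer to `A` that
    -- keeps the hypotheses and cuts no less finishes by induction. Connectivity of `S` plays no
    -- role here.
    have step : ∀ S' : Finset V, (∀ x ∈ S', x ∈ S ∨ x ∈ A) → (∀ x ∈ S, x ∈ A → x ∈ S') →
        ((∃ x ∈ S, x ∉ A ∧ x ∉ S') ∨ ∃ x ∈ A, x ∉ S ∧ x ∈ S') →
        (∀ x ∈ X, x ∈ S ↔ x ∈ S') →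
        (∀ r ∈ R, r ∈ S' ∨ ∃ w ∈ S', w ∉ X ∧ G.SameType X r w ∧
          G.degIn w Finset.univ ≤ G.degIn r Finset.univ) →
        G.cutSum S ≤ G.cutSum S' → G.cutSum S ≤ G.cutSum A := by
      intro S' ha hb hc hd he hf
      refine hf.trans (ih (symmDiff S' A) ?_ (fun x hx => (hd x hx).symm.trans (hSX x hx)) ?_ he
        rfl)
      · refine (Finset.ssubset_iff_of_subset fun x hx => ?_).2 ?_
        · simp only [Finset.mem_symmDiff] at hx ⊢
          rcases hx with ⟨hx, hx'⟩ | ⟨hx, hx'⟩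
          · exact Or.inl ⟨(ha x hx).resolve_right hx', hx'⟩
          · exact Or.inr ⟨hx, fun hx'' => hx' (hb x hx'' hx)⟩
        · simp only [Finset.mem_symmDiff]
          rcases hc with ⟨x, hx⟩ | ⟨x, hx⟩
          · exact ⟨x, by tauto⟩
          · exact ⟨x, by tauto⟩
      · exact fun u hu huA huX => hS u ((ha u hu).resolve_right huA) huA huX
    have hSub : ∀ v, v ∉ X → (∀ u ∈ S, u ∉ A → u ∉ X → ¬ G.Adj v u) →
        G.degIn v S ≤ G.degIn v A := by
      refine fun v hv h => degIn_mono fun w hw hvw => ?_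
      by_contra hwA
      exact h w hw hwA (fun hwX => hwA ((hSX w hwX).1 hw)) hvw
    -- Exchanging the twins `u` and `v` does not decrease the cut. If `u` was the substitute for
    -- some `r ∈ R`, then `v`, of equal type and degree, takes over.
    have swap : ∀ v ∈ A, v ∉ S → v ∉ X → ∀ u ∈ S, u ∉ A → u ∉ X → G.Adj v u →
        G.cutSum S ≤ G.cutSum A := by
      intro v hvA hvS hvX u huS huA huX hvu
      have ht := hX.trueTwins hvX huX hvu
      have hvu' : v ≠ u := hvu.ne
      refine step (insert v (S.erase u)) ?_ ?_ (Or.inl ⟨u, huS, huA, ?_⟩) ?_ ?_ ?_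
      · simp only [Finset.mem_insert, Finset.mem_erase]; grind
      · simp only [Finset.mem_insert, Finset.mem_erase]; grind
      · simp [hvu'.symm]
      · simp only [Finset.mem_insert, Finset.mem_erase]; grind
      · intro r hr
        rcases hSR r hr with h | ⟨w, hw, hwX, hrw, hd⟩
        · left
          simp only [Finset.mem_insert, Finset.mem_erase]
          exact Or.inr ⟨fun e => huA (e ▸ hRA hr), h⟩
        · by_cases hwu : w = u
          · subst hwu
            refine Or.inr ⟨v, by simp, hvX, fun x hx => ?_, ?_⟩
            · rw [hrw x hx, ht.sameType hvX huX x hx]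
            · rwa [ht.degIn_eq _ (by simp)]
          · exact Or.inr ⟨w, by simp [hwu, hw], hwX, hrw, hd⟩
      · have e1 := G.cutSum_erase huS
        have e2 := G.cutSum_insert (v := v) (A := S.erase u) (by simp [hvS])
        have e3 := ht.degIn_eq (S.erase u) (by simp [hvS])
        have e4 := ht.degIn_eq Finset.univ (by simp)
        have e5 : G.degIn u (S.erase u) ≤ G.degIn u S :=
          degIn_mono fun w hw _ => Finset.mem_of_mem_erase hw
        omega
    have insertR : ∀ v ∈ A, v ∉ S → v ∉ X → 2 * G.degIn v S ≤ G.degIn v Finset.univ →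
        G.cutSum S ≤ G.cutSum A := by
      intro v hvA hvS hvX hd
      refine step (insert v S) ?_ ?_ (Or.inr ⟨v, hvA, hvS, by simp⟩) ?_ ?_ ?_
      · simp only [Finset.mem_insert]; grind
      · simp only [Finset.mem_insert]; grind
      · simp only [Finset.mem_insert]; grind
      · intro r hr
        rcases hSR r hr with h | ⟨w, hw, h⟩
        · exact Or.inl (by simp [h])
        · exact Or.inr ⟨w, by simp [hw], h⟩
      · have := G.cutSum_insert hvS
        omega
    by_cases hRS : R ⊆ S
    · by_cases hAS : A ⊆ S
      · by_cases hSA : S ⊆ A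
        · rw [hSA.antisymm hAS]
        · obtain ⟨u, huS, huA⟩ := Finset.not_subset.1 hSA
          have huX : u ∉ X := fun h => huA ((hSX u h).1 huS)
          -- Now `A ⊆ S`, so `u`, having been unprofitable for `A`, has at least as many neighbours
          -- in `S` and may be dropped.
          refine step (S.erase u) ?_ ?_ (Or.inl ⟨u, huS, huA, by simp⟩) ?_ ?_ ?_
          · simp only [Finset.mem_erase]; grind
          · simp only [Finset.mem_erase]; grind
          · simp only [Finset.mem_erase]; grind
          · exact fun r hr => Or.inl (by simp [hRS hr]; exact fun e => huA (e ▸ hRA hr))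
          · have e1 := G.cutSum_erase huS
            have e2 := h2 u huA huX (hS u huS huA huX)
            have e3 : G.degIn u A ≤ G.degIn u S := degIn_mono fun w hw _ => hAS hw
            omega
      · obtain ⟨v, hvA, hvS⟩ := Finset.not_subset.1 hAS
        have hvX : v ∉ X := fun h => hvS ((hSX v h).2 hvA)
        by_cases hu : ∃ u ∈ S, u ∉ A ∧ u ∉ X ∧ G.Adj v u
        · obtain ⟨u, huS, huA, huX, hvu⟩ := hu
          exact swap v hvA hvS hvX u huS huA huX hvu
        · push Not at hu
          -- No twin of `v` lies in `S` outside `A`, so `v` has at most as many neighbours in `S` as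
          -- in `A`, and adding it is profitable.
          have e1 := hSub v hvX fun u hu1 hu2 hu3 => hu u hu1 hu2 hu3
          have e2 := h1 v hvA hvX fun h => hvS (hRS h)
          exact insertR v hvA hvS hvX (by omega)
    · obtain ⟨r, hrR, hrS⟩ := Finset.not_subset.1 hRS
      have hrX := hRX r hrR
      by_cases hu : ∃ u ∈ S, u ∉ A ∧ u ∉ X ∧ G.Adj r u
      · obtain ⟨u, huS, huA, huX, hvu⟩ := hu
        exact swap r (hRA hrR) hrS hrX u huS huA huX hvu
      push Not at hu
      by_cases hu' : ∃ u ∈ S, u ∉ X ∧ G.Adj r u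
      · obtain ⟨u, huS, huX, hru⟩ := hu'
        have ht := hX.trueTwins hrX huX hru
        have huA : u ∈ A := by_contra fun h => hu u huS h huX hru
        have e1 := hSub r hrX fun u hu1 hu2 hu3 => hu u hu1 hu2 hu3
        -- The strict inequality is not assumed for `r ∈ R`. It is borrowed from the twin `u`, which
        -- has the same type as `r` and hence is not in `R`.
        have e2 := h1 u huA huX fun h => hru.ne (hR r hrR u h (ht.sameType hrX huX))
        have e3 := ht.degIn_eq A (by simp [huA, hRA hrR])
        have e4 := ht.degIn_eq Finset.univ (by simp)
        exact insertR r (hRA hrR) hrS hrX (by omega)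
      · push Not at hu'
        -- All neighbours of `r` in `S` now lie in `X`, so they are also neighbours of the
        -- substitute `w`, whose degree is at most that of `r`. Either `w ∈ A` and `r` inherits its
        -- inequality, or `w` is replaced by `r`.
        obtain ⟨w, hwS, hwX, hrw, hd⟩ := (hSR r hrR).resolve_left hrS
        have hSw : ∀ x ∈ S, G.Adj r x → x ∈ X ∧ G.Adj w x := fun x hx hrx => by
          have hxX : x ∈ X := by_contra fun h => hu' x hx h hrx
          exact ⟨hxX, (hrw x hxX).1 hrx⟩
        have hle : ∀ B : Finset V, (∀ x ∈ X, x ∈ S → x ∈ B) → G.degIn r S ≤ G.degIn w B := by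
          classical
          refine fun B hB => Finset.card_le_card fun x hx => ?_
          simp only [Finset.mem_filter] at hx ⊢
          exact ⟨hB x (hSw x hx.1 hx.2).1 hx.1, (hSw x hx.1 hx.2).2⟩
        by_cases hwA : w ∈ A
        · have e1 := hle A fun x hx hxS => (hSX x hx).1 hxS
          have e2 := h1 w hwA hwX fun h => hrS (hR r hrR w h hrw ▸ hwS)
          exact insertR r (hRA hrR) hrS hrX (by omega)
        · refine step (insert r (S.erase w)) ?_ ?_
            (Or.inr ⟨r, hRA hrR, hrS, by simp⟩) ?_ ?_ ?_
          · simp only [Finset.mem_insert, Finset.mem_erase]; grind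
          · simp only [Finset.mem_insert, Finset.mem_erase]; grind
          · simp only [Finset.mem_insert, Finset.mem_erase]; grind
          · intro r' hr'
            rcases hSR r' hr' with h | ⟨w', hw, hwX', hrw', hd'⟩
            · left
              simp only [Finset.mem_insert, Finset.mem_erase]
              exact Or.inr ⟨fun e => hwA (e ▸ hRA hr'), h⟩
            · by_cases hww : w' = w
              · subst hww
                have : r' = r := hR r' hr' r hrR fun x hx => by rw [hrw' x hx, hrw x hx]
                exact Or.inl (by simp [this])
              · exact Or.inr ⟨w', by simp [hww, hw], hwX', hrw', hd'⟩
          · have e1 := G.cutSum_erase hwS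
            have e2 := G.cutSum_insert (v := r) (A := S.erase w) (by simp [hrS])
            have e3 : G.degIn r (S.erase w) ≤ G.degIn r S :=
              degIn_mono fun w hw _ => Finset.mem_of_mem_erase hw
            have e4 := hle S fun x hx hxS => hxS
            omega

end SimpleGraph

/-! ### Connected sets, search trees and the starts. -/

namespace SimpleGraph

variable {V : Type*} {G : SimpleGraph V}

/-- In a connected induced subgraph everything is reached from `a` within as many rounds as there
are vertices. -/
theorem induce_connected_flood [Fintype V] {A : Set V} (h : (G.induce A).Connected) {a : V}
    (ha : a ∈ A) {f : ℕ → V → Prop} (h0 : f 0 a)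
    (hs : ∀ i < Fintype.card V, ∀ u v, f i u → u ∈ A → v ∈ A → (u = v ∨ G.Adj u v) → f (i + 1) v)
    {x : V} (hx : x ∈ A) : f (Fintype.card V) x := by
  classical
  obtain ⟨p, hp⟩ := (h.preconnected ⟨a, ha⟩ ⟨x, hx⟩).exists_isPath
  have hlen : p.length ≤ Fintype.card V :=
    hp.length_lt.le.trans (Fintype.card_subtype_le (· ∈ A))
  have key : ∀ {u v : A} (p : (G.induce A).Walk u v) (i : ℕ), i + p.length ≤ Fintype.card V →
      f i u → f (i + p.length) v := by
    intro u v p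
    induction p with
    | nil => exact fun i _ h => h
    | @cons u v w huv p ih =>
      intro i hi hf
      rw [Walk.length_cons] at hi ⊢
      have := ih (i + 1) (by omega) (hs i (by omega) u v hf u.2 v.2 (Or.inr huv))
      rwa [show i + (p.length + 1) = i + 1 + p.length by omega]
  -- The path may be shorter than the number of rounds; the case `u = v` of `hs` keeps `x` reached.
  have stay : ∀ k, p.length + k ≤ Fintype.card V → f (p.length + k) x := by
    intro k
    induction k with
    | zero => intro hk; simpa using key p 0 (by simpa using hk) h0
    | succ k ih =>
      intro hk
      have hk' : p.length + k < Fintype.card V := by omega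
      exact hs _ hk' x x (ih hk'.le) hx hx (Or.inl rfl)
  have := stay (Fintype.card V - p.length) (by omega)
  rwa [Nat.add_sub_cancel' hlen] at this

theorem induce_connected_of_reflTransGen {A : Set V} {a : V} (ha : a ∈ A)
    (h : ∀ x ∈ A, Relation.ReflTransGen (fun u v => v ∈ A ∧ G.Adj u v) a x) :
    (G.induce A).Connected := by
  have key : ∀ x, Relation.ReflTransGen (fun u v => v ∈ A ∧ G.Adj u v) a x →
      ∃ hx : x ∈ A, (G.induce A).Reachable ⟨a, ha⟩ ⟨x, hx⟩ := by
    intro x hx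
    induction hx with
    | refl => exact ⟨ha, Reachable.refl _⟩
    | @tail b c _ hbc ih =>
      obtain ⟨hb, hr⟩ := ih
      have : (G.induce A).Adj ⟨b, hb⟩ ⟨c, hbc.1⟩ := hbc.2
      exact ⟨hbc.1, hr.trans this.reachable⟩
  have key' : ∀ x : A, (G.induce A).Reachable ⟨a, ha⟩ x := fun x => (key x (h x x.2)).2
  exact connected_iff _ |>.2 ⟨fun x y => (key' x).symm.trans (key' y), ⟨⟨a, ha⟩⟩⟩

theorem reflTransGen_of_induce_connected {A : Set V} (h : (G.induce A).Connected) {a x : V}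
    (ha : a ∈ A) (hx : x ∈ A) : Relation.ReflTransGen (fun u v => v ∈ A ∧ G.Adj u v) a x := by
  have : ∀ {u v : A}, (G.induce A).Walk u v →
      Relation.ReflTransGen (fun u v => v ∈ A ∧ G.Adj u v) (u : V) v := by
    intro u v p
    induction p with
    | nil => exact .refl
    | @cons u v w huv p ih => exact .head ⟨v.2, huv⟩ ih
  exact this (h.preconnected ⟨a, ha⟩ ⟨x, hx⟩).some

theorem induce_connected_insert {A : Set V} (h : (G.induce A).Connected) {a v : V} (ha : a ∈ A)
    (hav : G.Adj a v) : (G.induce (insert v A)).Connected := by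
  have key : ∀ x ∈ A, Relation.ReflTransGen (fun u w => w ∈ insert v A ∧ G.Adj u w) a x :=
    fun x hx => Relation.ReflTransGen.mono
      (fun u w huw => ⟨Set.mem_insert_of_mem _ huw.1, huw.2⟩)
      _ _ (reflTransGen_of_induce_connected h ha hx)
  refine induce_connected_of_reflTransGen (Set.mem_insert_of_mem _ ha) fun x hx => ?_
  rcases hx with rfl | hx
  · exact .single ⟨Set.mem_insert _ _, hav⟩
  · exact key x hx

/-- A breadth first search tree of a connected induced subgraph. -/
theorem exists_bfs_tree {X : Finset V} (hX : G.IsTwinCover X) {S : Set V}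
    (h : (G.induce S).Connected) {a : V} (ha : a ∈ S) (haX : a ∈ X) :
    ∃ (p : V → V) (d : V → ℕ), (∀ x ∈ S, x ≠ a → p x ∈ S ∧ G.Adj (p x) x ∧ d (p x) < d x) ∧
      ∀ x ∈ S, x ∉ X → p x ∈ X := by
  classical
  let d : V → ℕ := fun x => if hx : x ∈ S then (G.induce S).dist ⟨a, ha⟩ ⟨x, hx⟩ else 0
  have hd : ∀ x y, x ∈ S → y ∈ S → G.Adj x y → d y ≤ d x + 1 := by
    intro x y hx hy hxy
    simp only [d, dif_pos hx, dif_pos hy]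
    have e : (G.induce S).Adj ⟨x, hx⟩ ⟨y, hy⟩ := hxy
    exact (h.dist_triangle (v := (⟨x, hx⟩ : S))).trans (by rw [dist_eq_one_iff_adj.2 e])
  have hp : ∀ x, ∃ y, x ∈ S → x ≠ a → y ∈ S ∧ G.Adj y x ∧ d x = d y + 1 := by
    intro x
    by_cases hx : x ∈ S
    swap
    · exact ⟨x, fun h => absurd h hx⟩
    obtain ⟨p, hp⟩ := h.exists_walk_length_eq_dist ⟨x, hx⟩ ⟨a, ha⟩
    cases p with
    | nil => exact ⟨a, fun _ h => absurd rfl h⟩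
    | @cons _ y _ hxy p =>
      refine ⟨y, fun _ _ => ⟨y.2, hxy.symm, (hd y x y.2 hx hxy.symm).antisymm ?_⟩⟩
      have := dist_le p
      simp only [d, dif_pos hx, dif_pos y.2]
      rw [dist_comm, dist_comm (u := (⟨a, ha⟩ : S)) (v := ⟨x, hx⟩), ← hp, Walk.length_cons]
      exact Nat.succ_le_succ this
  choose p hp using hp
  refine ⟨p, d, fun x hx hxa => ?_, fun x hx hxX => ?_⟩
  · obtain ⟨h1, h2, h3⟩ := hp x hx hxa
    exact ⟨h1, h2, by omega⟩
  · by_contra hpX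
    -- If `p x` were outside `X` too, it would be a twin of `x`, and the grandparent would be
    -- adjacent to `x`, contradicting the distances.
    obtain ⟨h1, h2, h3⟩ := hp x hx fun e => hxX (e ▸ haX)
    obtain ⟨h1', h2', h3'⟩ := hp _ h1 fun e => hpX (e ▸ haX)
    have ht := hX.trueTwins hpX hxX h2
    have : p (p x) ≠ x := fun e => by rw [e] at h3'; omega
    have := hd _ x h1' hx ((ht.adj_iff h2'.ne this).1 h2'.symm).symm
    omega

/-- A connected set avoiding the twin-cover is a clique: the closed neighbourhood of `a` is passed
on along edges between twins. -/
theorem adj_of_connected_of_disjoint [Fintype V] {X : Finset V} (hX : G.IsTwinCover X)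
    {S : Set V} (h : (G.induce S).Connected) (hSX : ∀ x ∈ S, x ∉ X) {a x : V} (ha : a ∈ S)
    (hx : x ∈ S) (hxa : x ≠ a) : G.Adj x a := by
  refine (induce_connected_flood h ha (f := fun _ x => x = a ∨ G.Adj x a) (Or.inl rfl)
    (fun _ _ u v hu huS hvS huv => ?_) hx).resolve_left hxa
  rcases huv with rfl | huv
  · exact hu
  rcases hu with rfl | hu
  · exact Or.inr huv.symm
  · by_cases hva : v = a
    · exact Or.inl hva
    · have := (hX.trueTwins (hSX u huS) (hSX v hvS) huv).adj_iff (w := a) hu.ne.symm (Ne.symm hva)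
      exact Or.inr (this.1 hu)

/-- Among the vertices outside `X` of its type, `r` has the largest score. -/
def IsRep (G : SimpleGraph V) (X : Finset V) (score : V → ℕ) (r : V) : Prop :=
  r ∉ X ∧ ∀ u, u ∉ X → G.SameType X u r → score u ≤ score r

/-- The vertex set described by a relation `b` on `X` and a vertex `a`: if `a ∈ X` then row `a` of
`b` is its trace on `X`, and the other rows are the types of its vertices outside `X`; if `a ∉ X`
it is `{a}`. -/
def InStart (G : SimpleGraph V) (X : Finset V) (score : V → ℕ) (b : V → V → Prop) (a w : V) :
    Prop :=
  (a ∈ X ∧ ((w ∈ X ∧ b a w) ∨ (G.IsRep X score w ∧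
    ∃ x ∈ X, x ≠ a ∧ (∃ y ∈ X, b x y) ∧ ∀ y ∈ X, G.Adj w y ↔ b x y))) ∨ (a ∉ X ∧ w = a)

theorem exists_isRep [Fintype V] {X : Finset V} (score : V → ℕ) {w : V} (hw : w ∉ X) :
    ∃ r, G.IsRep X score r ∧ G.SameType X w r := by
  classical
  obtain ⟨r, hr, hmax⟩ := Finset.exists_max_image
    (Finset.univ.filter fun r => r ∉ X ∧ G.SameType X w r) score ⟨w, Finset.mem_filter.2 ⟨Finset.mem_univ _, hw, fun _ _ => Iff.rfl⟩⟩
  simp only [Finset.mem_filter, Finset.mem_univ, true_and] at hr hmax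
  exact ⟨r, ⟨hr.1, fun u hu hur => hmax u ⟨hu, fun x hx => by rw [hr.2 x hx, hur x hx]⟩⟩, hr.2⟩

/-- For every connected set `S` there is a start from which a greedy enlargement leads to a cut at
least as large as that of `S`. -/
theorem exists_start [Fintype V] [DecidableEq V] {X : Finset V} (hX : G.IsTwinCover X)
    {score : V → ℕ} (hinj : Function.Injective score)
    (hscore : ∀ u v, score u ≤ score v → G.degIn u Finset.univ ≤ G.degIn v Finset.univ)
    {S : Finset V} (hS : (G.induce (S : Set V)).Connected) :
    ∃ (b : V → V → Prop) (a : V), ∀ A₀ : Finset V, (∀ w, w ∈ A₀ ↔ G.InStart X score b a w) →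
      (G.induce (A₀ : Set V)).Connected ∧ ∀ A : Finset V, A₀ ⊆ A → (∀ x ∈ A, x ∈ X → x ∈ A₀) →
        (∀ v ∈ A, v ∉ A₀ → 2 * G.degIn v A < G.degIn v Finset.univ) →
        (∀ v ∉ A, v ∉ X → (∃ a ∈ A₀, G.Adj v a) →
          G.degIn v Finset.univ ≤ 2 * G.degIn v A) →
        G.cutSum S ≤ G.cutSum A := by
  classical
  by_cases hSX : ∃ a ∈ S, a ∈ X
  · obtain ⟨a, haS, haX⟩ := hSX
    obtain ⟨p, d, hp, hpX⟩ := exists_bfs_tree hX hS (a := a) (by simpa using haS) haX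
    simp only [Finset.mem_coe] at hp hpX
    -- Row `a` is free for the trace of `S` because the root has no parent. A row `x ≠ a` is
    -- nonempty exactly when `x` needs a connector outside `X`, since it then contains `x` itself.
    refine ⟨fun x y => if x = a then y ∈ S else x ∈ S ∧ p x ∉ X ∧ G.Adj (p x) y, a,
      fun A₀ hA₀ => ?_⟩
    have hin : ∀ w ∈ X, w ∈ A₀ ↔ w ∈ S := by
      intro w hw
      rw [hA₀]
      simp [InStart, haX, hw, IsRep]
    have hout : ∀ w ∉ X, w ∈ A₀ ↔ G.IsRep X score w ∧
        ∃ x ∈ X, x ≠ a ∧ x ∈ S ∧ p x ∉ X ∧ G.SameType X w (p x) := by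
      intro w hw
      rw [hA₀]
      simp only [InStart, haX, hw, true_and, false_and, false_or, not_true_eq_false, or_false]
      refine and_congr_right fun _ => exists_congr fun x => and_congr_right fun hx =>
        and_congr_right fun hxa => ?_
      simp only [hxa, if_false]
      constructor
      · rintro ⟨⟨y, -, h1, h2, -⟩, h3⟩
        exact ⟨h1, h2, fun y hy => by rw [h3 y hy]; tauto⟩
      · rintro ⟨h1, h2, h3⟩
        exact ⟨⟨x, hx, h1, h2, (hp x h1 hxa).2.1⟩, fun y hy => by rw [h3 y hy]; tauto⟩
    have haA : a ∈ A₀ := (hin a haX).2 haS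
    refine ⟨?_, fun A hA hAX h1 h2 => ?_⟩
    -- Vertices of `S ∩ X` are reached by induction on the depth; a parent outside `X` is bypassed
    -- through its representative `r`, which is adjacent to both the grandparent and `x`.
    · have key : ∀ k, ∀ x ∈ S, x ∈ X → d x = k →
          Relation.ReflTransGen (fun u v => v ∈ (A₀ : Set V) ∧ G.Adj u v) a x := by
        intro k
        induction k using Nat.strong_induction_on with
        | _ k ih =>
          intro x hxS hxX hk
          by_cases hxa : x = a
          · rw [hxa]
          obtain ⟨q1, q2, q3⟩ := hp x hxS hxa
          have hxA : x ∈ (A₀ : Set V) := (hin x hxX).2 hxS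
          by_cases hpx : p x ∈ X
          · exact (ih _ (hk ▸ q3) _ q1 hpx rfl).tail ⟨hxA, q2⟩
          · obtain ⟨q1', q2', q3'⟩ := hp _ q1 fun e => hpx (e ▸ haX)
            have hppx := hpX _ q1 hpx
            obtain ⟨r, hr, hrt⟩ := exists_isRep (G := G) score hpx
            have hrA : r ∈ A₀ := (hout r hr.1).2
              ⟨hr, x, hxX, hxa, hxS, hpx, fun y hy => (hrt y hy).symm⟩
            exact ((ih _ (hk ▸ q3'.trans q3) _ q1' hppx rfl).tail
              ⟨hrA, ((hrt _ hppx).1 q2'.symm).symm⟩).tail ⟨hxA, (hrt _ hxX).1 q2⟩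
      refine induce_connected_of_reflTransGen (a := a) haA fun x hx => ?_
      have hx' : x ∈ A₀ := hx
      by_cases hxX : x ∈ X
      · exact key _ x ((hin x hxX).1 hx') hxX rfl
      · obtain ⟨hr, y, hyX, hya, hyS, hpy, ht⟩ := (hout x hxX).1 hx'
        exact (key _ y hyS hyX rfl).tail ⟨hx, ((ht y hyX).2 (hp y hyS hya).2.1).symm⟩
    · refine cutSum_le_of_greedy (A₀ := A₀) (R := A₀.filter (· ∉ X)) hX
        ((Finset.filter_subset _ _).trans hA) (fun r hr => (Finset.mem_filter.1 hr).2) ?_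
        (fun v hv hvX hvR => h1 v hv fun h => hvR (Finset.mem_filter.2 ⟨h, hvX⟩)) h2
        (fun x hx => ⟨fun h => hA ((hin x hx).2 h), fun h => (hin x hx).1 (hAX x h hx)⟩)
        (fun u hu huA huX => ?_) (fun r hr => ?_)
      -- Representatives of one type have equal score and thus coincide, as scores are injective.
      · intro r hr r' hr' ht
        rw [Finset.mem_filter] at hr hr'
        have e1 := ((hout r hr.2).1 hr.1).1
        have e2 := ((hout r' hr'.2).1 hr'.1).1
        exact hinj ((e2.2 r hr.2 ht).antisymm (e1.2 r' hr'.2 fun x hx => (ht x hx).symm))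
      · have hpu := hpX u hu huX
        obtain ⟨q1, q2, -⟩ := hp u hu fun e => huX (e ▸ haX)
        exact ⟨p u, (hin _ hpu).2 q1, q2.symm⟩
      · rw [Finset.mem_filter] at hr
        obtain ⟨hrep, x, hxX, hxa, hxS, hpx, ht⟩ := (hout r hr.2).1 hr.1
        exact Or.inr ⟨p x, (hp x hxS hxa).1, hpx, ht,
          hscore _ _ (hrep.2 _ hpx fun y hy => (ht y hy).symm)⟩
  · push Not at hSX
    obtain ⟨⟨a, ha⟩⟩ := hS.nonempty
    have haS : a ∈ S := ha
    have haX := hSX a haS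
    refine ⟨fun _ _ => False, a, fun A₀ hA₀ => ?_⟩
    have hA₀' : ∀ w, w ∈ A₀ ↔ w = a := fun w => by rw [hA₀]; simp [InStart, haX]
    refine ⟨?_, fun A hA hAX h1 h2 => ?_⟩
    · refine induce_connected_of_reflTransGen (a := a) ((hA₀' a).2 rfl) fun x hx => ?_
      rw [(hA₀' x).1 hx]
    · have hAX' : ∀ x ∈ A, x ∉ X := fun x hx hxX =>
        haX ((hA₀' x).1 (hAX x hx hxX) ▸ hxX)
      refine cutSum_le_of_greedy (A₀ := A₀) (R := A₀) hX hA
        (fun r hr => by rwa [(hA₀' r).1 hr]) ?_ (fun v hv _ hvR => h1 v hv hvR) h2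
        (fun x hx => ⟨fun h => absurd hx (hSX x h), fun h => absurd hx (hAX' x h)⟩)
        (fun u hu huA huX => ⟨a, (hA₀' a).2 rfl, ?_⟩) (fun r hr => Or.inl ?_)
      · exact fun r hr r' hr' _ => by rw [(hA₀' r).1 hr, (hA₀' r').1 hr']
      · exact adj_of_connected_of_disjoint hX hS hSX haS hu
          fun e => huA (hA ((hA₀' u).2 e))
      · rwa [(hA₀' r).1 hr]

end SimpleGraph

/-! ### Expressions for the graph predicates, and their meaning. -/

namespace RAM

/-- The expression has a nonzero value. -/
def Tr (e : Ex) (s : State) : Prop := e.eval s ≠ 0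

/-- The entry of the array is nonzero. -/
def On (s : State) (A i : ℕ) : Prop := s.mem A i ≠ 0

@[simp] theorem on_setReg (s : State) (r v A i : ℕ) : On (s.setReg r v) A i ↔ On s A i := Iff.rfl

theorem on_setMem (s : State) (A i v B j : ℕ) :
    On (s.setMem A i v) B j ↔ if B = A ∧ j = i then v ≠ 0 else On s B j := by
  unfold On
  rw [State.mem_setMem]
  split_ifs <;> rfl

namespace Ex

/-- Negation. -/
def not (e : Ex) : Ex := cond e (lit 0) (lit 1)
/-- Conjunction. -/
def and (a b : Ex) : Ex := cond a b (lit 0)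
/-- Disjunction. -/
def or (a b : Ex) : Ex := cond a (lit 1) b
/-- Equivalence. -/
def iff (a b : Ex) : Ex := cond a b b.not
/-- Strict comparison. -/
def lt (a b : Ex) : Ex := sub b a
/-- Comparison. -/
def le (a b : Ex) : Ex := (b.lt a).not
/-- Equality. -/
def eq (a b : Ex) : Ex := (a.le b).and (b.le a)
/-- Universal quantification over the numbers below register `0`. -/
def all (r : ℕ) (e : Ex) : Ex := (sum r e.not).not
/-- The number of values of `r` below register `0` with the given property. -/
def count (r : ℕ) (e : Ex) : Ex := sum r (cond e (lit 1) (lit 0))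
/-- The product with register `0`; variable `39` must not occur in `e`. -/
def mulSize (e : Ex) : Ex := sum 39 e
/-- The address of the entry in row `u` and column `v` of a square matrix. -/
def cell (u v : ℕ) : Ex := (mulSize (var u)).add (var v)

section Truth
variable {s : State}

@[simp] theorem tr_not {e : Ex} : Tr e.not s ↔ ¬ Tr e s := by
  by_cases h : e.eval s = 0 <;> simp [Tr, not, eval, h]

@[simp] theorem tr_and {a b : Ex} : Tr (a.and b) s ↔ Tr a s ∧ Tr b s := by
  by_cases h : a.eval s = 0 <;> simp [Tr, and, eval, h]

@[simp] theorem tr_or {a b : Ex} : Tr (a.or b) s ↔ Tr a s ∨ Tr b s := by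
  by_cases h : a.eval s = 0 <;> simp [Tr, or, eval, h]

@[simp] theorem tr_iff {a b : Ex} : Tr (a.iff b) s ↔ (Tr a s ↔ Tr b s) := by
  by_cases h : a.eval s = 0 <;> by_cases h' : b.eval s = 0 <;> simp [Tr, iff, not, eval, h, h']

@[simp] theorem tr_lt {a b : Ex} : Tr (a.lt b) s ↔ a.eval s < b.eval s := by
  simp only [Tr, lt, eval]; omega

@[simp] theorem tr_le {a b : Ex} : Tr (a.le b) s ↔ a.eval s ≤ b.eval s := by
  simp [le]

@[simp] theorem tr_eq {a b : Ex} : Tr (a.eq b) s ↔ a.eval s = b.eval s := by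
  simp [eq]; omega

@[simp] theorem tr_sum {r : ℕ} {e : Ex} :
    Tr (sum r e) s ↔ ∃ i < s.reg 0, Tr e (s.setReg r i) := by
  simp [Tr, eval]

@[simp] theorem tr_all {r : ℕ} {e : Ex} :
    Tr (all r e) s ↔ ∀ i < s.reg 0, Tr e (s.setReg r i) := by
  simp [all]

@[simp] theorem tr_get {A : ℕ} {e : Ex} : Tr (get A e) s ↔ On s A (e.eval s) := Iff.rfl

@[simp] theorem eval_var {r : ℕ} : (var r).eval s = s.reg r := rfl

@[simp] theorem eval_lit {c : ℕ} : (lit c).eval s = c := rfl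

open scoped Classical in
theorem eval_cond {c a b : Ex} :
    (cond c a b).eval s = if Tr c s then a.eval s else b.eval s := by
  simp only [eval, Tr]
  congr

open scoped Classical in
theorem eval_count {r : ℕ} {e : Ex} :
    (count r e).eval s = ∑ i ∈ Finset.range (s.reg 0), if Tr e (s.setReg r i) then 1 else 0 := by
  rw [count, eval]
  exact Finset.sum_congr rfl fun i _ => eval_cond

theorem eval_cell {u v : ℕ} (hu : u ≠ 39) : (cell u v).eval s = s.reg 0 * s.reg u + s.reg v := by
  simp [cell, mulSize, eval, hu]

end Truth

/-- Adjacency of two vertices. -/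
def adj (u v : ℕ) : Ex := get 0 (cell u v)
/-- Membership in the twin-cover. -/
def inX (u : ℕ) : Ex := get 1 (var u)
/-- The entry of the guessed relation on the twin-cover. -/
def bit (u v : ℕ) : Ex := get 3 (cell u v)
/-- Membership in the current vertex set. -/
def inS (u : ℕ) : Ex := get 4 (var u)
/-- Membership in the set of vertices reached so far. -/
def inQ (u : ℕ) : Ex := get 5 (var u)
/-- Equality of the closed neighbourhoods. -/
def twins (u v : ℕ) : Ex :=
  all 30 (((var 30).eq (var u)).or (adj u 30) |>.iff (((var 30).eq (var v)).or (adj v 30)))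
/-- Equality of the neighbourhoods in the twin-cover. -/
def sameType (u v : ℕ) : Ex := all 30 ((inX 30).not.or ((adj u 30).iff (adj v 30)))
/-- A number by which to order the vertices by degree, and those of the same degree by index. -/
def score (u : ℕ) : Ex := (mulSize (count 30 (adj u 30))).add (var u)
/-- The vertex has the largest score among the vertices of its type outside the twin-cover. -/
def isRep (w : ℕ) : Ex :=
  (inX w).not.and (all 31 ((inX 31).or ((sameType 31 w).not.or ((score 31).le (score w)))))
/-- Membership of `w` in the set described by the guessed relation and the vertex `a`. -/
def inStart (a w : ℕ) : Ex :=
  ((inX a).and (((inX w).and (bit a w)).or ((isRep w).and (sum 32 ((inX 32).and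
    (((var 32).eq (var a)).not.and ((sum 30 ((inX 30).and (bit 32 30))).and
      (all 30 ((inX 30).not.or ((adj w 30).iff (bit 32 30)))))))))))
  |>.or ((inX a).not.and ((var w).eq (var a)))
/-- The size of the cut of the current vertex set. -/
def cut : Ex := sum 31 (count 30 ((inS 31).and ((inS 30).not.and (adj 31 30))))

end Ex

/-- The state holds the graph `G`. -/
structure Holds {n : ℕ} (G : SimpleGraph (Fin n)) (s : State) : Prop where
  size : s.reg 0 = n
  adj : ∀ i j : Fin n, On s 0 (n * i + j) ↔ G.Adj i j

open scoped Classical in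
/-- The set of vertices with nonzero entries in an array. -/
noncomputable def vset (n : ℕ) (s : State) (A : ℕ) : Finset (Fin n) :=
  Finset.univ.filter fun v => On s A v

@[simp] theorem mem_vset {n : ℕ} {s : State} {A : ℕ} {v : Fin n} : v ∈ vset n s A ↔ On s A v := by
  simp [vset]

/-- The relation stored in array `3`. -/
def bits (n : ℕ) (s : State) (i j : Fin n) : Prop := On s 3 (n * i + j)

theorem forall_lt_iff_fin {n : ℕ} {P : ℕ → Prop} : (∀ i < n, P i) ↔ ∀ i : Fin n, P i :=
  ⟨fun h i => h i i.2, fun h i hi => h ⟨i, hi⟩⟩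

theorem exists_lt_iff_fin {n : ℕ} {P : ℕ → Prop} : (∃ i < n, P i) ↔ ∃ i : Fin n, P i := by
  simp [Fin.exists_iff]

section Expressions
variable {n : ℕ} {G : SimpleGraph (Fin n)} {s : State} {i j : Fin n}

/-- The order of vertices computed by `Ex.score`. -/
noncomputable def scoreOf (G : SimpleGraph (Fin n)) (v : Fin n) : ℕ :=
  n * G.degIn v Finset.univ + v

/-- The index is below `n`, so it is the remainder modulo `n`. It breaks ties between equal degrees,
which makes representatives unique. -/
theorem scoreOf_injective (G : SimpleGraph (Fin n)) : Function.Injective (scoreOf G) := by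
  intro u v h
  have := congrArg (· % n) h
  simp only [scoreOf, Nat.mul_add_mod, Nat.mod_eq_of_lt u.2, Nat.mod_eq_of_lt v.2] at this
  exact Fin.ext this

theorem degIn_le_of_scoreOf_le {u v : Fin n} (h : scoreOf G u ≤ scoreOf G v) :
    G.degIn u Finset.univ ≤ G.degIn v Finset.univ := by
  by_contra hlt
  have h1 := Nat.mul_le_mul_left n (Nat.succ_le_of_lt (not_le.1 hlt))
  have h2 := v.2
  simp only [scoreOf, Nat.mul_succ] at h h1
  omega

theorem Holds.adj' (h : Holds G s) (i j : Fin n) : On s 0 (s.reg 0 * i + j) ↔ G.Adj i j :=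
  h.size.symm ▸ h.adj i j

theorem Holds.tr_adj (h : Holds G s) {u v : ℕ} (hu : u ≠ 39) (hi : s.reg u = i)
    (hj : s.reg v = j) : Tr (.adj u v) s ↔ G.Adj i j := by
  rw [Ex.adj, Ex.tr_get, Ex.eval_cell hu, hi, hj, h.adj']

theorem Holds.setReg (h : Holds G s) {r : ℕ} (hr : r ≠ 0) (v : ℕ) : Holds G (s.setReg r v) :=
  ⟨by simp [hr.symm, h.size], h.adj⟩

/-- Registers from `30` on are bound variables of expressions, whence the bounds on `u` and `v`.
Adjacency is assumed because the expression compares only closed neighbourhoods. -/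
theorem Holds.tr_twins (h : Holds G s) {u v : ℕ} (hu : u < 30) (hv : v < 30) (hi : s.reg u = i)
    (hj : s.reg v = j) (hij : G.Adj i j) : Tr (.twins u v) s ↔ G.TrueTwins i j := by
  simp only [Ex.twins, Ex.tr_all, h.size, forall_lt_iff_fin, SimpleGraph.TrueTwins, hij, true_and,
    Set.ext_iff]
  refine forall_congr' fun k => ?_
  have h' := h.setReg (r := 30) (by decide) k
  simp only [Ex.tr_iff, Ex.tr_or, Ex.tr_eq, Ex.eval_var, State.reg_setReg, if_true,
    if_neg hu.ne, if_neg hv.ne, hi, hj, Fin.val_inj, Set.mem_insert_iff,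
    SimpleGraph.mem_neighborSet]
  rw [h'.tr_adj (i := i) (j := k) (by omega) (by simp [hu.ne, hi]) (by simp),
    h'.tr_adj (i := j) (j := k) (by omega) (by simp [hv.ne, hj]) (by simp)]

theorem Holds.tr_sameType (h : Holds G s) {u v : ℕ} (hu : u < 39) (hv : v < 39) (hu' : u ≠ 30)
    (hv' : v ≠ 30) (hi : s.reg u = i) (hj : s.reg v = j) :
    Tr (.sameType u v) s ↔ G.SameType (vset n s 1) i j := by
  simp only [Ex.sameType, Ex.tr_all, h.size, forall_lt_iff_fin, SimpleGraph.SameType]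
  refine forall_congr' fun k => ?_
  have h' := h.setReg (r := 30) (by decide) k
  simp only [Ex.tr_iff, Ex.tr_or, Ex.tr_not, Ex.inX, Ex.tr_get, Ex.eval_var, State.reg_setReg,
    if_true, on_setReg, mem_vset]
  rw [h'.tr_adj (i := i) (j := k) (by omega) (by simp [hu', hi]) (by simp),
    h'.tr_adj (i := j) (j := k) (by omega) (by simp [hv', hj]) (by simp)]
  tauto

theorem Holds.eval_score (h : Holds G s) {u : ℕ} (hu : u < 39) (hu' : u ≠ 30)
    (hi : s.reg u = i) : (Ex.score u).eval s = scoreOf G i := by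
  classical
  have : ∀ k, (Ex.count 30 (.adj u 30)).eval (s.setReg 39 k) = G.degIn i Finset.univ := by
    intro k
    have h' := h.setReg (r := 39) (by decide) k
    rw [Ex.eval_count, h'.size, Finset.sum_range, SimpleGraph.degIn, Finset.card_filter]
    refine Finset.sum_congr rfl fun l _ => ?_
    simp only [(h'.setReg (r := 30) (by decide) l).tr_adj (i := i) (j := l) (u := u) (v := 30)
      (by omega) (by simp [hu', hi, hu.ne]) (by simp)]
  simp only [Ex.score, Ex.eval, Ex.mulSize, this, h.size, hi, scoreOf, Finset.sum_const,
    Finset.card_range, smul_eq_mul]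

theorem Holds.tr_isRep (h : Holds G s) {w : ℕ} (hw : w < 30) (hi : s.reg w = i) :
    Tr (.isRep w) s ↔ G.IsRep (vset n s 1) (scoreOf G) i := by
  simp only [Ex.isRep, Ex.tr_and, Ex.tr_all, h.size, forall_lt_iff_fin, SimpleGraph.IsRep,
    Ex.tr_not, Ex.inX, Ex.tr_get, Ex.eval_var, hi, mem_vset]
  refine and_congr_right fun _ => forall_congr' fun k => ?_
  have h' := h.setReg (r := 31) (by decide) k
  simp only [Ex.tr_or, Ex.tr_not, Ex.tr_get, Ex.eval_var, State.reg_setReg, if_true, on_setReg,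
    Ex.tr_le]
  rw [h'.tr_sameType (i := k) (j := i) (by omega) (by omega) (by omega) (by omega) (by simp)
      (by simp [show w ≠ 31 by omega, hi]),
    h'.eval_score (i := k) (by omega) (by omega) (by simp),
    h'.eval_score (i := i) (by omega) (by omega) (by simp [show w ≠ 31 by omega, hi])]
  have : vset n (s.setReg 31 k) 1 = vset n s 1 := rfl
  rw [this]
  tauto

theorem Holds.tr_bit (h : Holds G s) {u v : ℕ} (hu : u ≠ 39) (hi : s.reg u = i)
    (hj : s.reg v = j) : Tr (.bit u v) s ↔ bits n s i j := by
  rw [Ex.bit, Ex.tr_get, Ex.eval_cell hu, hi, hj, h.size, bits]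

theorem Holds.tr_inStart (h : Holds G s) {a w : ℕ} (ha : a < 30) (hw : w < 30)
    (hi : s.reg a = i) (hj : s.reg w = j) :
    Tr (.inStart a w) s ↔ G.InStart (vset n s 1) (scoreOf G) (bits n s) i j := by
  have e32 : a ≠ 32 := by omega
  have e32' : w ≠ 32 := by omega
  have e30' : w ≠ 30 := by omega
  simp only [Ex.inStart, Ex.tr_and, Ex.tr_or, Ex.tr_sum, Ex.tr_all, h.size, forall_lt_iff_fin,
    exists_lt_iff_fin, SimpleGraph.InStart, Ex.tr_not, Ex.inX, Ex.tr_get, Ex.tr_eq, Ex.eval_var,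
    h.tr_isRep hw hj, hi, hj, h.tr_bit (show a ≠ 39 by omega) hi hj, mem_vset, Fin.val_inj,
    State.reg_setReg, if_true, on_setReg, if_neg e32, Ex.tr_iff, if_neg (show 0 ≠ 32 by decide)]
  have hb : ∀ k l : Fin n, Tr (.bit 32 30) ((s.setReg 32 k).setReg 30 l) ↔ bits n s k l :=
    fun k l => ((h.setReg (r := 32) (by decide) k).setReg (r := 30) (by decide) l).tr_bit
      (by decide) (by simp) (by simp)
  have hadj : ∀ k l : Fin n, Tr (.adj w 30) ((s.setReg 32 k).setReg 30 l) ↔ G.Adj j l :=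
    fun k l => ((h.setReg (r := 32) (by decide) k).setReg (r := 30) (by decide) l).tr_adj
      (by omega) (by simp [e30', e32', hj]) (by simp)
  simp only [hb, hadj, ← imp_iff_not_or]

theorem Holds.eval_cut (h : Holds G s) : Ex.cut.eval s = G.cutSum (vset n s 4) := by
  classical
  simp only [Ex.cut, Ex.eval, h.size, Finset.sum_range, SimpleGraph.cutSum]
  refine Finset.sum_congr rfl fun k _ => ?_
  have h' := h.setReg (r := 31) (by decide) k
  rw [Ex.eval_count, h'.size, Finset.sum_range]
  refine Finset.sum_congr rfl fun l _ => ?_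
  have h'' := h'.setReg (r := 30) (by decide) l
  simp only [Ex.tr_and, Ex.tr_not, Ex.inS, Ex.tr_get, Ex.eval_var, State.reg_setReg, if_true,
    on_setReg, mem_vset, h''.tr_adj (i := k) (j := l) (u := 31) (v := 30) (by decide) (by simp)
    (by simp), if_neg (show 31 ≠ 30 by decide)]

end Expressions
end RAM

/-! ### The commands of the algorithm, and the twin-cover. Register `9` is a dummy: `set 9 (lit 0)`
serves as an empty branch. -/

namespace RAM
namespace Cmd
open Ex

/-- Put both ends of the edges that are uncovered so far into the twin-cover, for one pair. -/
def coverStep : Cmd :=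
  cond ((adj 10 11).and ((inX 10).not.and ((inX 11).not.and (twins 10 11).not)))
    (seq (put 1 (var 10) (lit 1)) (put 1 (var 11) (lit 1))) (set 9 (lit 0))
/-- Compute a twin-cover. -/
def cover : Cmd := loop 10 (loop 11 coverStep)

/-- Give the next power of two to one pair, if it lies in the twin-cover. -/
def powersStep : Cmd :=
  cond ((inX 10).and (inX 11))
    (seq (put 2 (cell 10 11) (var 3)) (set 3 ((var 3).add (var 3)))) (set 9 (lit 0))
/-- Assign powers of two to the pairs in the twin-cover; the next one is left in register `3`. -/
def powers : Cmd := seq (set 3 (lit 1)) (loop 10 (loop 11 powersStep))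

/-- Extract the binary digit of one pair. -/
def decodeStep : Cmd :=
  seq (set 12 (((var 0).sub (lit 1)).sub (var 10))) <|
  seq (set 13 (((var 0).sub (lit 1)).sub (var 11))) <|
  cond ((inX 12).and (inX 13))
    (cond ((get 2 (cell 12 13)).le (var 5))
      (seq (put 3 (cell 12 13) (lit 1)) (set 5 ((var 5).sub (get 2 (cell 12 13)))))
      (put 3 (cell 12 13) (lit 0)))
    (set 9 (lit 0))
/-- Turn the number in register `4` into a relation on the twin-cover. -/
def decode : Cmd := seq (set 5 (var 4)) (loop 10 (loop 11 decodeStep))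

/-- Mark one vertex as reached if it has a neighbour that is. -/
def floodStep : Cmd :=
  cond ((inS 15).and (sum 20 ((inQ 20).and (((var 20).eq (var 15)).or (adj 20 15)))))
    (put 5 (var 15) (lit 1)) (set 9 (lit 0))
/-- Mark only the first vertex of the current set as reached. -/
def floodInit : Cmd :=
  loop 14 (put 5 (var 14) ((inS 14).and (sum 20 ((inS 20).and ((var 20).lt (var 14)))).not))
/-- Put into register `8` the size of the cut plus one if the current vertex set is connected, and
zero otherwise. -/
def value : Cmd :=
  seq floodInit <| seq (loop 14 (loop 15 floodStep)) <|
  set 8 (.cond ((sum 20 (inS 20)).and (all 20 ((inS 20).not.or (inQ 20))))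
    ((lit 1).add cut) (lit 0))

/-- Add one vertex outside the twin-cover to the current set if this increases the value. -/
def greedyStep : Cmd :=
  cond ((inX 16).or (inS 16)) (set 9 (lit 0)) <|
  seq (put 4 (var 16) (lit 1)) <| seq value <|
  cond ((var 7).lt (var 8)) (set 7 (var 8)) (put 4 (var 16) (lit 0))
/-- Enlarge the current set greedily, with its value in register `7`. -/
def greedy : Cmd := seq value (seq (set 7 (var 8)) (loop 16 greedyStep))

/-- Initialize the current set. -/
def start : Cmd := loop 16 (put 4 (var 16) (inStart 17 16))
/-- Try all starts belonging to the number in register `4`; the best value found so far is in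
register `6`. -/
def round : Cmd :=
  seq decode <| loop 17 <| seq start <| seq greedy <|
  cond ((var 6).lt (var 7)) (set 6 (var 7)) (set 9 (lit 0))

/-- The preparations. -/
def prepare : Cmd := seq cover powers

theorem wf_round : round.wf = true := by decide
theorem wf_prepare : prepare.wf = true := by decide
end Cmd

theorem Holds.run {n : ℕ} {G : SimpleGraph (Fin n)} {s : State} (h : Holds G s) {c : Cmd}
    (h0 : 0 ∉ c.regs) (h0' : 0 ∉ c.arrs) : Holds G (c.run s) :=
  ⟨by rw [Cmd.reg_run h0, h.size], fun i j => by rw [On, Cmd.mem_run h0']; exact h.adj i j⟩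

theorem on_run {c : Cmd} {A : ℕ} (h : A ∉ c.arrs) (s : State) (i : ℕ) :
    On (c.run s) A i ↔ On s A i := by rw [On, Cmd.mem_run h]; rfl

theorem vset_run {c : Cmd} {A : ℕ} (h : A ∉ c.arrs) (n : ℕ) (s : State) :
    vset n (c.run s) A = vset n s A := by ext; simp [on_run h]

namespace Cmd
open Ex

theorem run_seq (c c' : Cmd) (s : State) : (seq c c').run s = c'.run (c.run s) := rfl

open scoped Classical in
theorem run_cond (e : Ex) (c c' : Cmd) (s : State) :
    (cond e c c').run s = if Tr e s then c.run s else c'.run s := by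
  simp only [run, Tr]
  congr

theorem run_set (r : ℕ) (e : Ex) (s : State) : (set r e).run s = s.setReg r (e.eval s) := rfl

theorem run_put (A : ℕ) (a e : Ex) (s : State) :
    (put A a e).run s = s.setMem A (a.eval s) (e.eval s) := rfl

theorem loop_induction {n r : ℕ} {c : Cmd} {s : State} (P : ℕ → State → Prop)
    (hr0 : r ≠ 0) (hc0 : 0 ∉ c.regs) (hn : s.reg 0 = n) (h0 : P 0 s)
    (hs : ∀ i < n, ∀ s, s.reg 0 = n → P i s → P (i + 1) (c.run (s.setReg r i))) :
    P n ((loop r c).run s) := by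
  have := forRun_induction (f := fun i s => c.run (s.setReg r i)) (n := n) (s := s)
    (fun i s => s.reg 0 = n ∧ P i s) ⟨hn, h0⟩ fun i hi s ⟨h1, h2⟩ =>
      ⟨by simp [reg_run hc0, hr0.symm, h1], hs i hi s h1 h2⟩
  simp only [run, hn]
  exact this.2

/-- Two nested loops over all pairs, with an invariant indexed by the number of pairs treated. -/
theorem loop_loop_induction {n r r' : ℕ} {c : Cmd} {s : State} (P : ℕ → State → Prop)
    (hr0 : r ≠ 0) (hr0' : r' ≠ 0) (hrr : r ≠ r') (hc0 : 0 ∉ c.regs) (hcr : r ∉ c.regs)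
    (hn : s.reg 0 = n) (h0 : P 0 s) (hP : ∀ k s v, P k s → P k (s.setReg r v))
    (hP' : ∀ k s v, P k s → P k (s.setReg r' v))
    (hs : ∀ i j : Fin n, ∀ s, s.reg 0 = n → s.reg r = (i : ℕ) → s.reg r' = (j : ℕ) → P (n * i + j) s →
      P (n * i + j + 1) (c.run s)) :
    P (n * n) ((loop r (loop r' c)).run s) := by
  refine loop_induction (fun i s => P (n * i) s) hr0 (by simp [regs, hr0'.symm, hc0]) hn
    (by simpa using h0) fun i hi s h1 h2 => ?_
  rw [mul_add_one]
  refine (loop_induction (fun j s => s.reg r = i ∧ P (n * i + j) s) hr0' hc0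
    (by simp [hr0.symm, h1]) ⟨by simp, hP _ _ _ h2⟩ fun j hj s h3 h4 => ⟨?_, ?_⟩).2
  · rw [reg_run hcr]; simp [hrr, h4.1]
  · exact hs ⟨i, hi⟩ ⟨j, hj⟩ _ (by simp [hr0'.symm, h3]) (by simp [hrr, h4.1]) (by simp)
      (hP' _ _ _ h4.2)

/-- The addresses `n * i + j` are distinct for distinct pairs, so one step of a double loop treats
exactly one new pair. -/
theorem pair_lt_succ_iff {n : ℕ} {i j i' j' : Fin n} :
    n * (i : ℕ) + j < n * i' + j' + 1 ↔ n * (i : ℕ) + j < n * i' + j' ∨ (i = i' ∧ j = j') := by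
  rw [Nat.lt_succ_iff_lt_or_eq]
  refine or_congr_right ⟨fun h => ?_, by rintro ⟨rfl, rfl⟩; rfl⟩
  have h1 := congrArg (· / n) h
  have h2 := congrArg (· % n) h
  have hn := i.pos
  simp only [Nat.mul_add_div hn, Nat.div_eq_of_lt j.2, Nat.div_eq_of_lt j'.2, add_zero] at h1
  simp only [Nat.mul_add_mod, Nat.mod_eq_of_lt j.2, Nat.mod_eq_of_lt j'.2] at h2
  exact ⟨Fin.ext h1, Fin.ext h2⟩

theorem pair_lt {n : ℕ} (i j : Fin n) : n * (i : ℕ) + j < n * n := by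
  have := Nat.mul_le_mul_left n (Nat.succ_le_of_lt i.2)
  have := j.2
  rw [Nat.mul_succ] at *
  omega

section
variable {n : ℕ} {G : SimpleGraph (Fin n)}

/-- A greedily built twin-cover is at most twice as large as any other one. -/
theorem cover_spec {s : State} (h : Holds G s) (hX : vset n s 1 = ∅) :
    G.IsTwinCover (vset n (cover.run s) 1) ∧
      (vset n (cover.run s) 1).card ≤ 2 * G.twinCoverNumber := by
  classical
  have key := loop_loop_induction (n := n) (r := 10) (r' := 11) (c := coverStep) (s := s)
    (fun k s => Holds G s ∧
      (∀ i j : Fin n, n * (i : ℕ) + j < k → G.Adj i j →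
        i ∈ vset n s 1 ∨ j ∈ vset n s 1 ∨ G.TrueTwins i j) ∧
      -- Each step that adds vertices adds at most two, and every twin-cover `Y` contains at least
      -- one of the two ends, both of which are new.
      ∀ Y : Finset (Fin n), G.IsTwinCover Y →
        (vset n s 1).card ≤ 2 * (Y ∩ vset n s 1).card)
    (by decide) (by decide) (by decide) (by decide) (by decide) h.size
    ⟨h, by simp, by simp [hX]⟩
    (fun k s v ⟨h1, h2⟩ => ⟨h1.setReg (by decide) v, h2⟩)
    (fun k s v ⟨h1, h2⟩ => ⟨h1.setReg (by decide) v, h2⟩) ?_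
  · obtain ⟨h1, h2, h3⟩ := key
    refine ⟨fun u v huv => h2 u v (pair_lt u v) huv, ?_⟩
    obtain ⟨Y, hY, hYc⟩ : ∃ Y : Finset (Fin n), G.IsTwinCover Y ∧ Y.card = G.twinCoverNumber :=
      Nat.sInf_mem (s := {m | ∃ X : Finset (Fin n), G.IsTwinCover X ∧ X.card = m})
        ⟨_, Finset.univ, fun u v _ => Or.inl (Finset.mem_univ u), rfl⟩
    rw [← hYc]
    exact (h3 Y hY).trans (Nat.mul_le_mul_left 2 (Finset.card_le_card Finset.inter_subset_left))
  · intro i j s h0 hi hj ⟨h1, h2, h3⟩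
    refine ⟨h1.run (by decide) (by decide), ?_⟩
    rw [coverStep, run_cond]
    simp only [tr_and, tr_not, inX, tr_get, eval_var, hi, hj,
      h1.tr_adj (u := 10) (v := 11) (by decide) hi hj, ← mem_vset]
    split_ifs with hc
    · obtain ⟨hij, hiX, hjX, ht⟩ := hc
      rw [h1.tr_twins (by decide) (by decide) hi hj hij] at ht
      have hv : vset n ((seq (put 1 (var 10) (lit 1)) (put 1 (var 11) (lit 1))).run s) 1 =
          insert i (insert j (vset n s 1)) := by
        ext k
        simp only [mem_vset, run_seq, run_put, on_setMem, Finset.mem_insert, eval_var, eval_lit,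
          State.reg_setMem, hi, hj, Fin.val_inj, true_and]
        split_ifs <;> simp_all
      rw [hv]
      refine ⟨fun i' j' hlt hadj => ?_, fun Y hY => ?_⟩
      · rcases pair_lt_succ_iff.1 hlt with h | ⟨rfl, rfl⟩
        · rcases h2 i' j' h hadj with h | h | h
          · exact Or.inl (by simp only [Finset.mem_insert]; tauto)
          · exact Or.inr (Or.inl (by simp only [Finset.mem_insert]; tauto))
          · exact Or.inr (Or.inr h)
        · exact Or.inl (by simp)
      · have h3' := h3 Y hY
        have e1 : (insert i (insert j (vset n s 1))).card ≤ (vset n s 1).card + 2 :=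
          (Finset.card_insert_le _ _).trans (Nat.succ_le_succ (Finset.card_insert_le _ _))
        have e2 : (Y ∩ vset n s 1).card < (Y ∩ insert i (insert j (vset n s 1))).card := by
          refine Finset.card_lt_card ((Finset.ssubset_iff_of_subset fun x => ?_).2 ?_)
          · simp only [Finset.mem_inter, Finset.mem_insert]; tauto
          · rcases hY i j hij with h | h | h
            · exact ⟨i, by simp [h], by simp only [Finset.mem_inter]; tauto⟩
            · exact ⟨j, by simp [h], by simp only [Finset.mem_inter]; tauto⟩
            · exact absurd h ht
        omega
    · refine ⟨fun i' j' hlt hadj => ?_, h3⟩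
      rcases pair_lt_succ_iff.1 hlt with h | ⟨rfl, rfl⟩
      · exact h2 i' j' h hadj
      · by_cases ht : G.TrueTwins i' j'
        · exact Or.inr (Or.inr ht)
        · rw [h1.tr_twins (by decide) (by decide) hi hj hadj] at hc
          change i' ∈ vset n s 1 ∨ j' ∈ vset n s 1 ∨ _
          tauto

end
end Cmd
end RAM

/-! ### Guessed relations as binary numbers. -/

namespace RAM
namespace Cmd
open Ex

open scoped Classical in
/-- The power of two belonging to the place `p` when the places with property `D` are numbered. -/
noncomputable def weight (D : ℕ → Prop) (p : ℕ) : ℕ := 2 ^ ((Finset.range p).filter D).card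

open scoped Classical in
/-- The number whose binary digits, at the places with property `D` below `k`, are given by `b`. -/
noncomputable def encode (D b : ℕ → Prop) (k : ℕ) : ℕ :=
  ∑ p ∈ Finset.range k, if D p ∧ b p then weight D p else 0

section Weights
variable {D b : ℕ → Prop}

theorem weight_succ_of_mem {p : ℕ} (h : D p) : weight D (p + 1) = weight D p + weight D p := by
  classical
  rw [weight, weight, Finset.range_add_one, Finset.filter_insert, if_pos h,
    Finset.card_insert_of_notMem (by simp), pow_succ, mul_two]

theorem weight_succ_of_notMem {p : ℕ} (h : ¬ D p) : weight D (p + 1) = weight D p := by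
  classical
  rw [weight, weight, Finset.range_add_one, Finset.filter_insert, if_neg h]

theorem encode_succ_of_mem {p : ℕ} (h : D p) (h' : b p) :
    encode D b (p + 1) = encode D b p + weight D p := by
  simp [encode, Finset.sum_range_succ, h, h']

theorem encode_succ_of_not {p : ℕ} (h : ¬ (D p ∧ b p)) :
    encode D b (p + 1) = encode D b p := by
  rw [encode, Finset.sum_range_succ, if_neg h, add_zero, encode]

/-- The lower digits together are smaller than the next power of two. This justifies reading digits
off from the top, and shows that counting up to `weight D (n * n)` meets every relation. -/
theorem encode_lt_weight (D b : ℕ → Prop) (p : ℕ) : encode D b p < weight D p := by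
  induction p with
  | zero => simp [encode, weight]
  | succ p ih =>
    by_cases h : D p
    · rw [weight_succ_of_mem h]
      by_cases h' : b p
      · rw [encode_succ_of_mem h h']; omega
      · rw [encode_succ_of_not (by tauto)]; omega
    · rw [weight_succ_of_notMem h, encode_succ_of_not (by tauto)]
      exact ih

end Weights

/-- The address belongs to a pair in the twin-cover. -/
def PairInX (n : ℕ) (s : State) (p : ℕ) : Prop := On s 1 (p / n) ∧ On s 1 (p % n)

theorem pairInX_iff {n : ℕ} {s : State} {i j : Fin n} :
    PairInX n s (n * i + j) ↔ i ∈ vset n s 1 ∧ j ∈ vset n s 1 := by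
  have hn := i.pos
  simp only [PairInX, Nat.mul_add_div hn, Nat.div_eq_of_lt j.2, Nat.mul_add_mod,
    Nat.mod_eq_of_lt j.2, add_zero, mem_vset]

theorem pairInX_congr {n : ℕ} {s s' : State} (h : s.mem 1 = s'.mem 1) :
    PairInX n s = PairInX n s' := by
  ext p; simp [PairInX, On, h]

/-- The digits are numbered by pairs in `X × X` only, so the number of guesses depends on `|X|` and
not on `n`. -/
theorem weight_pairInX_le (n : ℕ) (s : State) :
    weight (PairInX n s) (n * n) ≤ 2 ^ (vset n s 1).card ^ 2 := by
  classical
  refine Nat.pow_le_pow_right two_pos ?_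
  rw [sq, ← Finset.card_product]
  refine (Finset.card_le_card fun p hp => ?_).trans
    (Finset.card_image_le (f := fun q : Fin n × Fin n => n * (q.1 : ℕ) + q.2))
  rw [Finset.mem_filter, Finset.mem_range] at hp
  have hn : 0 < n := Nat.pos_of_ne_zero fun h => by simp [h] at hp
  refine Finset.mem_image.2 ⟨(⟨p / n, Nat.div_lt_of_lt_mul hp.1⟩, ⟨p % n, Nat.mod_lt p hn⟩),
    ?_, Nat.div_add_mod p n⟩
  simpa [PairInX] using hp.2

section
variable {n : ℕ} {G : SimpleGraph (Fin n)}

theorem powers_spec {s : State} (h : Holds G s) :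
    (powers.run s).reg 3 = weight (PairInX n s) (n * n) ∧
      ∀ i j : Fin n, i ∈ vset n s 1 → j ∈ vset n s 1 →
        (powers.run s).mem 2 (n * i + j) = weight (PairInX n s) (n * i + j) := by
  set D := PairInX n s with hD
  have key := loop_loop_induction (n := n) (r := 10) (r' := 11) (c := powersStep)
    (s := (set 3 (lit 1)).run s)
    (fun k s' => s'.mem 1 = s.mem 1 ∧ s'.reg 3 = weight D k ∧
      ∀ i j : Fin n, n * (i : ℕ) + j < k → i ∈ vset n s 1 → j ∈ vset n s 1 →
        s'.mem 2 (n * i + j) = weight D (n * i + j))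
    (by decide) (by decide) (by decide) (by decide) (by decide)
    (by simp [run_set, h.size]) ⟨rfl, by simp [run_set, weight], by simp⟩
    (fun k s v h => by simpa using h) (fun k s v h => by simpa using h) ?_
  · exact ⟨key.2.1, fun i j => key.2.2 i j (pair_lt i j)⟩
  · intro i j s' h0 hi hj ⟨h1, h2, h3⟩
    have e1 : ∀ i : Fin n, On s' 1 i ↔ i ∈ vset n s 1 := fun i => by
      rw [mem_vset, On, h1]; rfl
    refine ⟨by rw [mem_run (by decide), h1], ?_⟩
    have hc := pairInX_iff (s := s) (i := i) (j := j)
    rw [← hD] at hc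
    rw [powersStep, run_cond]
    simp only [tr_and, inX, tr_get, eval_var, hi, hj, e1]
    split_ifs with hc' <;> rw [← hc] at hc'
    · simp only [run_seq, run_put, run_set, eval_var, eval_cell (show 10 ≠ 39 by decide), hi, hj,
        h0, h2, State.mem_setReg, State.reg_setReg, if_true]
      refine ⟨?_, fun i' j' hlt hi' hj' => ?_⟩
      · rw [weight_succ_of_mem hc']
        simp [eval, h2]
      · rw [State.mem_setMem]
        rcases pair_lt_succ_iff.1 hlt with h | ⟨rfl, rfl⟩
        · rw [if_neg (by omega)]
          exact h3 i' j' h hi' hj'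
        · simp
    · refine ⟨?_, fun i' j' hlt hi' hj' => ?_⟩
      · rw [weight_succ_of_notMem hc']
        simpa [run_set] using h2
      · rcases pair_lt_succ_iff.1 hlt with h | ⟨rfl, rfl⟩
        · exact h3 i' j' h hi' hj'
        · exact absurd (hc.2 ⟨hi', hj'⟩) hc'

/-- The digit at the highest remaining address is one exactly when the remaining number is at least
its weight. After `k` steps the remainder encodes the digits below `n * n - k`. -/
theorem decode_spec {s : State} (h : Holds G s) {D : ℕ → Prop} (hD : D = PairInX n s)
    (hw : ∀ i j : Fin n, i ∈ vset n s 1 → j ∈ vset n s 1 →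
      s.mem 2 (n * i + j) = weight D (n * i + j))
    {b : ℕ → Prop} (hb : s.reg 4 = encode D b (n * n)) {i j : Fin n} (hi : i ∈ vset n s 1)
    (hj : j ∈ vset n s 1) : bits n (decode.run s) i j ↔ b (n * i + j) := by
  have key := loop_loop_induction (n := n) (r := 10) (r' := 11) (c := decodeStep)
    (s := (set 5 (var 4)).run s)
    (fun k s' => s'.mem 1 = s.mem 1 ∧ s'.mem 2 = s.mem 2 ∧ s'.reg 5 = encode D b (n * n - k) ∧
      ∀ i j : Fin n, n * n - k ≤ n * (i : ℕ) + j → i ∈ vset n s 1 → j ∈ vset n s 1 →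
        (On s' 3 (n * i + j) ↔ b (n * i + j)))
    (by decide) (by decide) (by decide) (by decide) (by decide)
    (by simp [run_set, h.size]) ⟨rfl, rfl, by simp [run_set, hb], fun i j hij => ?_⟩
    (fun k s v h => by simpa using h) (fun k s v h => by simpa using h) ?_
  · exact key.2.2.2 i j (by simp) hi hj
  · have := pair_lt i j
    omega
  · intro i j s' h0 hi hj ⟨h1, h2, h3, h4⟩
    refine ⟨by rw [mem_run (by decide), h1], by rw [mem_run (by decide), h2], ?_⟩
    -- The loops count upwards; reflecting both indices visits the addresses in decreasing order.
    set i' : Fin n := ⟨n - 1 - i, by have := i.2; omega⟩ with hi'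
    set j' : Fin n := ⟨n - 1 - j, by have := j.2; omega⟩ with hj'
    have hp1 : n * n - (n * i + j) = (n * i' + j') + 1 := by
      obtain ⟨a, ha⟩ := Nat.exists_eq_add_of_lt i.2
      obtain ⟨c, hc⟩ := Nat.exists_eq_add_of_lt j.2
      have e1 : (i' : ℕ) = a := by simp only [hi']; omega
      have e2 : (j' : ℕ) = c := by simp only [hj']; omega
      have e3 : n * n = n * i + n * a + n :=
        (congrArg (n * ·) ha).trans (by ring)
      rw [e1, e2, e3]
      omega
    have hp2 : n * n - (n * i + j + 1) = n * i' + j' := by omega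
    rw [hp1] at h3 h4
    rw [hp2]
    set p := n * (i' : ℕ) + j' with hp
    have hstep : ∀ u v : Fin n, p ≤ n * (u : ℕ) + v →
        p + 1 ≤ n * (u : ℕ) + v ∨ (u = i' ∧ v = j') := by
      intro u v huv
      rcases Nat.lt_or_ge p (n * u + v) with h | h
      · exact Or.inl h
      · exact Or.inr ((pair_lt_succ_iff.1 (Nat.lt_succ_of_le h)).resolve_left (by omega))
    set s'' := (s'.setReg 12 i').setReg 13 j' with hs''
    have erun : decodeStep.run s' = (cond ((inX 12).and (inX 13))
      (cond ((get 2 (cell 12 13)).le (var 5))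
        (seq (put 3 (cell 12 13) (lit 1)) (set 5 ((var 5).sub (get 2 (cell 12 13)))))
        (put 3 (cell 12 13) (lit 0)))
      (set 9 (lit 0))).run s'' := by
      rw [decodeStep, run_seq, run_seq, run_set, run_set]
      simp [eval, h0, hi, hj, hs'', hi', hj']
    have ecell : (cell 12 13).eval s'' = p := by
      simp [eval_cell, hs'', h0, hp]
    have e0 : ∀ A k, On s'' A k ↔ On s' A k := fun A k => Iff.rfl
    have e1 : ∀ i : Fin n, On s' 1 i ↔ i ∈ vset n s 1 := fun i => by
      rw [mem_vset, On, h1]; rfl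
    have e2 : s''.mem = s'.mem := rfl
    have e5 : s''.reg 5 = s'.reg 5 := by simp [hs'']
    have hDp : D p ↔ i' ∈ vset n s 1 ∧ j' ∈ vset n s 1 := by rw [hD]; exact pairInX_iff
    rw [erun, run_cond]
    simp only [tr_and, inX, tr_get, eval_var, e0, show s''.reg 12 = i' by simp [hs''],
      show s''.reg 13 = j' by simp [hs''], e1]
    split_ifs with hc <;> rw [← hDp] at hc
    · have hw' : s''.mem 2 p = weight D p := by
        rw [e2, h2]; exact hw i' j' (hDp.1 hc).1 (hDp.1 hc).2
      have hlt := encode_lt_weight D b p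
      have hle : Tr ((get 2 (cell 12 13)).le (var 5)) s'' ↔ b p := by
        simp only [tr_le, eval, ecell, hw', e5, h3]
        by_cases hbp : b p
        · simp [encode_succ_of_mem hc hbp, hbp]
        · rw [encode_succ_of_not (by tauto)]
          simp only [hbp, iff_false]
          omega
      rw [run_cond]
      split_ifs with hbp <;> rw [hle] at hbp
      · refine ⟨?_, fun u v huv hu hv => ?_⟩
        · simp [run_seq, run_put, run_set, eval, ecell, State.mem_setMem, hw', e5, h3,
            encode_succ_of_mem hc hbp, show (cell 12 13).eval (s''.setMem 3 p 1) = p by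
              simp [eval_cell, hs'', h0, hp]]
        · simp only [run_seq, run_put, run_set, ecell, on_setReg, on_setMem, eval_lit, e0, true_and]
          rcases hstep u v huv with h | ⟨rfl, rfl⟩
          · rw [if_neg (by omega)]
            exact h4 u v h hu hv
          · rw [if_pos hp.symm]
            exact iff_of_true one_ne_zero hbp
      · refine ⟨?_, fun u v huv hu hv => ?_⟩
        · simpa [run_put, e5, encode_succ_of_not (show ¬ (D p ∧ b p) by tauto)] using h3
        · simp only [run_put, ecell, on_setMem, eval_lit, e0, true_and]
          rcases hstep u v huv with h | ⟨rfl, rfl⟩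
          · rw [if_neg (by omega)]
            exact h4 u v h hu hv
          · rw [if_pos hp.symm]
            exact iff_of_false (fun h => h rfl) hbp
    · refine ⟨?_, fun u v huv hu hv => ?_⟩
      · simpa [run_set, e5, encode_succ_of_not (show ¬ (D p ∧ b p) by tauto)] using h3
      · rcases hstep u v huv with h | ⟨rfl, rfl⟩
        · exact h4 u v h hu hv
        · exact absurd (hDp.2 ⟨hu, hv⟩) hc

end
end Cmd
end RAM

/-! ### Connectivity test, greedy enlargement and one round. -/

namespace SimpleGraph
variable {V : Type*}

/-- The vertices of `S` reached from `a` within the given number of rounds. -/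
def ReachedIn (G : SimpleGraph V) (S : Finset V) (a : V) : ℕ → V → Prop
  | 0, v => v = a
  | i + 1, v => v ∈ S ∧ ∃ u, G.ReachedIn S a i u ∧ (u = v ∨ G.Adj u v)

open scoped Classical in
/-- The size of the cut plus one for a connected set, and zero for other sets. -/
noncomputable def valueOf [Fintype V] (G : SimpleGraph V) (S : Finset V) : ℕ :=
  if (G.induce (S : Set V)).Connected then G.cutSum S + 1 else 0

/-- The set `A₀` is connected and each greedy enlargement of it has a cut of size at least `T`. -/
def Leads [Fintype V] (G : SimpleGraph V) (X A₀ : Finset V) (T : ℕ) : Prop :=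
  (G.induce (A₀ : Set V)).Connected ∧ ∀ A : Finset V, A₀ ⊆ A → (∀ x ∈ A, x ∈ X → x ∈ A₀) →
    (∀ v ∈ A, v ∉ A₀ → 2 * G.degIn v A < G.degIn v Finset.univ) →
    (∀ v ∉ A, v ∉ X → (∃ a ∈ A₀, G.Adj v a) → G.degIn v Finset.univ ≤ 2 * G.degIn v A) →
    T ≤ G.cutSum A

end SimpleGraph

namespace RAM
namespace Cmd
open Ex SimpleGraph

variable {n : ℕ} {G : SimpleGraph (Fin n)}

theorem floodInit_spec {s : State} (h : Holds G s) (v : Fin n) :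
    On (floodInit.run s) 5 v ↔ v ∈ vset n s 4 ∧ ∀ u ∈ vset n s 4, v ≤ u := by
  refine (loop_induction (n := n) (r := 14) (s := s)
    (fun k s' => s'.mem 4 = s.mem 4 ∧ ∀ v : Fin n, v < k →
      (On s' 5 v ↔ v ∈ vset n s 4 ∧ ∀ u ∈ vset n s 4, v ≤ u))
    (by decide) (by decide) h.size ⟨rfl, by simp⟩ ?_).2 v v.2
  intro i hi s' h0 ⟨h1, h2⟩
  refine ⟨by rw [mem_run (by decide)]; exact h1, fun v hv => ?_⟩
  have e4 : ∀ v : Fin n, On s' 4 v ↔ v ∈ vset n s 4 := fun v => by rw [mem_vset, On, h1]; rfl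
  rw [run_put, on_setMem]
  simp only [eval_var, State.reg_setReg, if_true, true_and]
  split_ifs with hvi
  · change Tr _ _ ↔ _
    simp only [tr_and, tr_not, inS, tr_get, eval_var, tr_sum, tr_lt, State.reg_setReg, if_true,
      on_setReg, if_neg (show 0 ≠ 14 by decide), if_neg (show 14 ≠ 20 by decide), h0,
      exists_lt_iff_fin, ← hvi, e4, Fin.val_fin_lt]
    simp only [not_exists, not_and, not_lt]
  · exact h2 v (by omega)

/-- Marks are set in place, so a round may reach further than one edge. Hence there are two
one-sided bounds: marked vertices are reachable, and those reached in `n` synchronous rounds are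
marked. -/
theorem flood_spec {s : State} (h : Holds G s) {a : Fin n}
    (hQ : ∀ v : Fin n, On s 5 v ↔ v = a) :
    (∀ v : Fin n, On ((loop 14 (loop 15 floodStep)).run s) 5 v →
      Relation.ReflTransGen (fun u v => v ∈ (vset n s 4 : Set (Fin n)) ∧ G.Adj u v) a v) ∧
    ∀ v : Fin n, G.ReachedIn (vset n s 4) a n v →
      On ((loop 14 (loop 15 floodStep)).run s) 5 v := by
  set S := vset n s 4 with hS
  set R : Fin n → Fin n → Prop := fun u v => v ∈ (S : Set (Fin n)) ∧ G.Adj u v with hR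
  let I : State → Prop := fun s' => Holds G s' ∧ s'.mem 4 = s.mem 4 ∧
    ∀ v : Fin n, On s' 5 v → Relation.ReflTransGen R a v
  have hI : ∀ s' r v, r ≠ 0 → I s' → I (s'.setReg r v) :=
    fun s' r v hr h => ⟨h.1.setReg hr v, h.2⟩
  have step : ∀ (s' : State) (j : Fin n), s'.reg 15 = j → I s' →
      I (floodStep.run s') ∧ (∀ v : Fin n, On s' 5 v → On (floodStep.run s') 5 v) ∧
      (j ∈ S → ∀ u : Fin n, On s' 5 u → (u = j ∨ G.Adj u j) → On (floodStep.run s') 5 j) := by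
    intro s' j hj ⟨h1, h2, h3⟩
    have e4 : ∀ v : Fin n, On s' 4 v ↔ v ∈ S := fun v => by rw [hS, mem_vset, On, h2]; rfl
    have hadj : ∀ u : Fin n, Tr (.adj 20 15) (s'.setReg 20 u) ↔ G.Adj u j := fun u =>
      (h1.setReg (r := 20) (by decide) u).tr_adj (by decide) (by simp) (by simp [hj])
    have hc : Tr ((inS 15).and (sum 20 ((inQ 20).and (((var 20).eq (var 15)).or (adj 20 15))))) s'
        ↔ j ∈ S ∧ ∃ u : Fin n, On s' 5 u ∧ (u = j ∨ G.Adj u j) := by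
      simp only [tr_and, inS, inQ, tr_get, eval_var, tr_sum, tr_or, tr_eq, State.reg_setReg,
        if_true, on_setReg, if_neg (show 15 ≠ 20 by decide), hj, h1.size, exists_lt_iff_fin, hadj,
        Fin.val_inj, e4]
    have hon : ∀ v : Fin n, On (floodStep.run s') 5 v ↔
        On s' 5 v ∨ (v = j ∧ j ∈ S ∧ ∃ u : Fin n, On s' 5 u ∧ (u = j ∨ G.Adj u j)) := by
      intro v
      rw [floodStep, run_cond]
      split_ifs with hc' <;> rw [hc] at hc'
      · simp only [run_put, on_setMem, eval_var, eval_lit, hj, Fin.val_inj, true_and]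
        split_ifs with hvj
        · exact iff_of_true one_ne_zero (Or.inr ⟨hvj, hc'⟩)
        · tauto
      · simp only [run_set, on_setReg]
        exact ⟨Or.inl, fun h => h.resolve_right fun h => hc' h.2⟩
    refine ⟨⟨h1.run (by decide) (by decide), by rw [mem_run (by decide), h2], fun v hv => ?_⟩,
      fun v hv => (hon v).2 (Or.inl hv),
      fun hjS u hu huj => (hon j).2 (Or.inr ⟨rfl, hjS, u, hu, huj⟩)⟩
    rcases (hon v).1 hv with hv | ⟨rfl, hjS, u, hu, rfl | huj⟩
    · exact h3 v hv
    · exact h3 _ hu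
    · exact (h3 u hu).tail ⟨hjS, huj⟩
  have key := loop_induction (n := n) (r := 14) (c := loop 15 floodStep) (s := s)
    (fun i s' => I s' ∧ ∀ v : Fin n, G.ReachedIn S a i v → On s' 5 v)
    (by decide) (by decide) h.size
    ⟨⟨h, rfl, fun v hv => by rw [(hQ v).1 hv]⟩, fun v hv => (hQ v).2 hv⟩ ?_
  · exact ⟨key.1.2.2, key.2⟩
  · intro i hi s₁ h0 ⟨h1, h2⟩
    have := loop_induction (n := n) (r := 15) (c := floodStep) (s := s₁.setReg 14 i)
      (fun j s' => I s' ∧ (∀ v : Fin n, G.ReachedIn S a i v → On s' 5 v) ∧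
        ∀ v : Fin n, v < j → G.ReachedIn S a (i + 1) v → On s' 5 v)
      (by decide) (by decide) (by simp [h0]) ⟨hI _ _ _ (by decide) h1, h2, by simp⟩ ?_
    · exact ⟨this.1, fun v => this.2.2 v v.2⟩
    · intro j hj s' h0' ⟨h3, h4, h5⟩
      obtain ⟨g1, g2, g3⟩ := step (s'.setReg 15 j) ⟨j, hj⟩ (by simp) (hI _ _ _ (by decide) h3)
      refine ⟨g1, fun v hv => g2 v (h4 v hv), fun v hv hvr => ?_⟩
      rcases Nat.lt_succ_iff_lt_or_eq.1 hv with hv | hv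
      · exact g2 v (h5 v hv hvr)
      · obtain ⟨hvS, u, hu, huv⟩ := hvr
        have hvj : v = ⟨j, hj⟩ := Fin.ext hv
        subst hvj
        exact g3 hvS u (h4 u hu) huv

theorem value_spec {s : State} (h : Holds G s) :
    (value.run s).reg 8 = G.valueOf (vset n s 4) := by
  set s₁ := floodInit.run s with hs₁
  set s₂ := (loop 14 (loop 15 floodStep)).run s₁ with hs₂
  have hh₁ : Holds G s₁ := h.run (by decide) (by decide)
  have hh₂ : Holds G s₂ := hh₁.run (by decide) (by decide)
  have hv₁ : vset n s₁ 4 = vset n s 4 := vset_run (by decide) n s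
  have hv₂ : vset n s₂ 4 = vset n s 4 := (vset_run (by decide) n s₁).trans hv₁
  have e4 : ∀ v : Fin n, On s₂ 4 v ↔ v ∈ vset n s 4 := fun v => by rw [← hv₂, mem_vset]
  have hrun : (value.run s).reg 8 = (Ex.cond ((sum 20 (inS 20)).and
      (all 20 ((inS 20).not.or (inQ 20)))) ((lit 1).add cut) (lit 0)).eval s₂ := by
    rw [value, run_seq, run_seq, run_set, ← hs₁, ← hs₂]
    simp
  have hcut : ((lit 1).add cut).eval s₂ = G.cutSum (vset n s 4) + 1 := by
    rw [eval, eval_lit, hh₂.eval_cut, hv₂, add_comm]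
  suffices hiff : Tr ((sum 20 (inS 20)).and (all 20 ((inS 20).not.or (inQ 20)))) s₂ ↔
      (G.induce (vset n s 4 : Set (Fin n))).Connected by
    rw [hrun, eval_cond, hcut, eval_lit, valueOf]
    by_cases hc : (G.induce (vset n s 4 : Set (Fin n))).Connected
    · rw [if_pos (hiff.2 hc), if_pos hc]
    · rw [if_neg (mt hiff.1 hc), if_neg hc]
  simp only [tr_and, tr_sum, tr_all, tr_or, tr_not, inS, inQ, tr_get, eval_var, on_setReg,
    State.reg_setReg, if_true, hh₂.size, exists_lt_iff_fin, forall_lt_iff_fin, e4,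
    ← imp_iff_not_or]
  constructor
  · rintro ⟨hne, hall⟩
    have hne' : (vset n s 4).Nonempty := hne
    set a := (vset n s 4).min' hne' with ha
    have haS : a ∈ vset n s 4 := Finset.min'_mem _ _
    have hQ : ∀ v : Fin n, On s₁ 5 v ↔ v = a := by
      intro v
      rw [floodInit_spec h]
      exact ⟨fun ⟨h1, h2⟩ => (h2 a haS).antisymm (Finset.min'_le _ _ h1),
        fun h => h ▸ ⟨haS, fun u hu => Finset.min'_le _ _ hu⟩⟩
    obtain ⟨g1, -⟩ := flood_spec hh₁ hQ
    rw [hv₁] at g1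
    exact induce_connected_of_reflTransGen haS fun x hx => g1 x (hall x hx)
  · intro hc
    obtain ⟨⟨b, hb⟩⟩ := hc.nonempty
    have hne' : (vset n s 4).Nonempty := ⟨b, hb⟩
    refine ⟨hne', fun x hx => ?_⟩
    set a := (vset n s 4).min' hne' with ha
    have haS : a ∈ vset n s 4 := Finset.min'_mem _ _
    have hQ : ∀ v : Fin n, On s₁ 5 v ↔ v = a := by
      intro v
      rw [floodInit_spec h]
      exact ⟨fun ⟨h1, h2⟩ => (h2 a haS).antisymm (Finset.min'_le _ _ h1),
        fun h => h ▸ ⟨haS, fun u hu => Finset.min'_le _ _ hu⟩⟩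
    obtain ⟨-, g2⟩ := flood_spec hh₁ hQ
    rw [hv₁] at g2
    refine g2 x ?_
    have := induce_connected_flood hc (a := a) (x := x) haS
      (f := G.ReachedIn (vset n s 4) a) rfl
      (fun i _ u v hu _ hv huv => ⟨hv, u, hu, huv⟩) hx
    rwa [Fintype.card_fin] at this

/-- The state of the greedy enlargement of `A₀` after the vertices below `k`. -/
def GreedyInv (G : SimpleGraph (Fin n)) (X A₀ : Finset (Fin n)) (k : ℕ) (S : Finset (Fin n)) :
    Prop :=
  A₀ ⊆ S ∧ (∀ x ∈ S, x ∈ X → x ∈ A₀) ∧ ((G.induce (A₀ : Set (Fin n))).Connected →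
    (G.induce (S : Set (Fin n))).Connected ∧
    (∀ v ∈ S, v ∉ A₀ → 2 * G.degIn v S < G.degIn v Finset.univ) ∧
    ∀ v : Fin n, v < k → v ∉ S → v ∉ X → (∃ a ∈ A₀, G.Adj v a) →
      G.degIn v Finset.univ ≤ 2 * G.degIn v S)

/-- One pass over the vertices suffices: the set only grows, so a vertex that does not pay stays so,
and accepted vertices keep their strict inequality because a later neighbour outside `X` is a twin.
Register `7` is the value of an actual set even if the start is disconnected. -/
theorem greedy_spec {s : State} (h : Holds G s) (hX : G.IsTwinCover (vset n s 1)) :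
    (∃ A, (greedy.run s).reg 7 = G.valueOf A) ∧
      ∀ T, G.Leads (vset n s 1) (vset n s 4) T → T + 1 ≤ (greedy.run s).reg 7 := by
  classical
  set X := vset n s 1 with hXdef
  set A₀ := vset n s 4 with hA₀
  have h0 : Holds G (value.run s) := h.run (by decide) (by decide)
  have hv0 : vset n (value.run s) 4 = A₀ := vset_run (by decide) n s
  have key := loop_induction (n := n) (r := 16) (c := greedyStep)
    (s := (set 7 (var 8)).run (value.run s))
    (fun k s' => Holds G s' ∧ vset n s' 1 = X ∧ s'.reg 7 = G.valueOf (vset n s' 4) ∧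
      GreedyInv G X A₀ k (vset n s' 4))
    (by decide) (by decide) (by simpa [run_set] using h0.size) ?_ ?_
  · obtain ⟨-, -, h3, h4, h5, h6⟩ := key
    refine ⟨⟨_, h3⟩, fun T hT => ?_⟩
    obtain ⟨g1, g2, g3⟩ := h6 hT.1
    refine le_of_le_of_eq ?_ h3.symm
    rw [valueOf, if_pos g1]
    exact Nat.succ_le_succ (hT.2 _ h4 h5 g2 fun v => g3 v v.2)
  · have e : vset n ((set 7 (var 8)).run (value.run s)) 4 = A₀ := hv0
    refine ⟨h0.setReg (by decide) _, vset_run (c := value) (by decide) n s, ?_, ?_⟩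
    · rw [e]
      simpa [run_set] using value_spec h
    · rw [e]
      exact ⟨subset_rfl, fun x hx _ => hx, fun hc => ⟨hc, fun v hv hv' => absurd hv hv', by simp⟩⟩
  · intro k hk s' hn ⟨h1, h2, h3, h4, h5, h6⟩
    set v : Fin n := ⟨k, hk⟩ with hv
    set s₁ := s'.setReg 16 k with hs₁
    have hh₁ : Holds G s₁ := h1.setReg (by decide) _
    have r16 : s₁.reg 16 = v := by simp [hs₁, hv]
    refine ⟨hh₁.run (by decide) (by decide), (vset_run (by decide) n s₁).trans h2, ?_⟩
    set S := vset n s' 4 with hS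
    have hS₁ : vset n s₁ 4 = S := rfl
    have hc : Tr ((inX 16).or (inS 16)) s₁ ↔ v ∈ X ∨ v ∈ S := by
      simp only [tr_or, inX, inS, tr_get, eval_var, r16, ← h2, hS, mem_vset]
      rfl
    have hlt : ∀ w : Fin n, (w : ℕ) < k + 1 → (w : ℕ) < k ∨ w = v := fun w hw =>
      (Nat.lt_succ_iff_lt_or_eq.1 hw).imp_right fun h => Fin.ext h
    rw [greedyStep, run_cond]
    split_ifs with hc' <;> rw [hc] at hc'
    · have e : vset n ((set 9 (lit 0)).run s₁) 4 = S := rfl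
      rw [e]
      refine ⟨by simpa [run_set, hs₁] using h3, h4, h5, fun hA => ?_⟩
      obtain ⟨g1, g2, g3⟩ := h6 hA
      refine ⟨g1, g2, fun w hw hwS hwX => ?_⟩
      rcases hlt w hw with hw | rfl
      · exact g3 w hw hwS hwX
      · exact absurd hc' (not_or.2 ⟨hwX, hwS⟩)
    · rw [not_or] at hc'
      obtain ⟨hvX, hvS⟩ := hc'
      rw [run_seq, run_seq, run_cond]
      set s₂ := (put 4 (var 16) (lit 1)).run s₁ with hs₂
      set s₃ := value.run s₂ with hs₃
      have hh₂ : Holds G s₂ := hh₁.run (by decide) (by decide)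
      have hS₂ : vset n s₂ 4 = insert v S := by
        ext w
        simp only [hs₂, run_put, mem_vset, on_setMem, eval_var, eval_lit, r16, true_and,
          Fin.val_inj, Finset.mem_insert, ← hS₁]
        split_ifs with hw <;> simp [hw]
      have hS₃ : vset n s₃ 4 = insert v S := (vset_run (by decide) n s₂).trans hS₂
      have r7 : s₃.reg 7 = G.valueOf S := by
        rw [hs₃, reg_run (by decide), ← h3]
        simp [hs₂, run_put, hs₁]
      have r8 : s₃.reg 8 = G.valueOf (insert v S) := by rw [hs₃, value_spec hh₂, hS₂]
      have r16' : s₃.reg 16 = v := by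
        rw [hs₃, reg_run (by decide), ← r16]
        simp [hs₂, run_put]
      have hins := G.cutSum_insert hvS
      have hval' : Tr ((var 7).lt (var 8)) s₃ ↔ G.valueOf S < G.valueOf (insert v S) := by
        rw [tr_lt, eval_var, eval_var, r7, r8]
      split_ifs with hval <;> rw [hval'] at hval
      · have e : vset n ((set 7 (var 8)).run s₃) 4 = insert v S := hS₃
        rw [e]
        refine ⟨by simp [run_set, r8], h4.trans (Finset.subset_insert _ _), fun x hx hxX => ?_,
          fun hA => ?_⟩
        · rcases Finset.mem_insert.1 hx with rfl | hx
          · exact absurd hxX hvX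
          · exact h5 x hx hxX
        · obtain ⟨g1, g2, g3⟩ := h6 hA
          have hconn : (G.induce ((insert v S : Finset (Fin n)) : Set (Fin n))).Connected := by
            by_contra hcon
            rw [valueOf, valueOf, if_neg hcon] at hval
            omega
          rw [valueOf, valueOf, if_pos hconn, if_pos g1] at hval
          have hdv : G.degIn v (insert v S) = G.degIn v S := by
            refine degIn_congr fun x => ?_
            simp only [Finset.mem_insert]
            refine ⟨fun ⟨h, h'⟩ => ⟨h.resolve_left h'.ne', h'⟩, fun ⟨h, h'⟩ => ⟨Or.inr h, h'⟩⟩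
          refine ⟨hconn, fun w hw hwA => ?_, fun w hw hwS hwX hwa => ?_⟩
          · rcases Finset.mem_insert.1 hw with rfl | hwS
            · omega
            · have hwX : w ∉ X := fun h => hwA (h5 w hwS h)
              by_cases hwv : G.Adj w v
              · have ht := hX.trueTwins hwX hvX hwv
                rw [ht.degIn_eq _ (by simp [hwS]), hdv, ht.degIn_eq Finset.univ (by simp)]
                omega
              · have : G.degIn w (insert v S) = G.degIn w S := by
                  refine degIn_congr fun x => ?_
                  simp only [Finset.mem_insert]
                  refine ⟨fun ⟨h, h'⟩ => ⟨h.resolve_left fun e => hwv (e ▸ h'), h'⟩,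
                    fun ⟨h, h'⟩ => ⟨Or.inr h, h'⟩⟩
                rw [this]
                exact g2 w hwS hwA
          · rw [Finset.mem_insert, not_or] at hwS
            have := g3 w ((hlt w hw).resolve_right hwS.1) hwS.2 hwX hwa
            exact this.trans (Nat.mul_le_mul_left 2
              (degIn_mono fun x hx _ => Finset.mem_insert_of_mem hx))
      · have e : vset n ((put 4 (var 16) (lit 0)).run s₃) 4 = S := by
          ext w
          have := Finset.ext_iff.1 hS₃ w
          rw [mem_vset, Finset.mem_insert] at this
          simp only [run_put, mem_vset, on_setMem, eval_var, eval_lit, r16', true_and,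
            Fin.val_inj]
          split_ifs with hw
          · exact iff_of_false (fun h => h rfl) (hw ▸ hvS)
          · rw [this]
            exact or_iff_right hw
        rw [e]
        refine ⟨by simpa [run_put] using r7, h4, h5, fun hA => ?_⟩
        obtain ⟨g1, g2, g3⟩ := h6 hA
        refine ⟨g1, g2, fun w hw hwS hwX hwa => ?_⟩
        rcases hlt w hw with hw | rfl
        · exact g3 w hw hwS hwX hwa
        · obtain ⟨a, ha, hwa⟩ := hwa
          -- A neighbour in `A₀` keeps the enlarged set connected, so the rejection was due to the
          -- cut.
          have hconn := induce_connected_insert g1 (a := a) (h4 ha) hwa.symm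
          rw [← Finset.coe_insert] at hconn
          rw [valueOf, valueOf, if_pos hconn, if_pos g1] at hval
          omega

theorem start_spec {s : State} (h : Holds G s) {a : Fin n} (ha : s.reg 17 = a) (w : Fin n) :
    w ∈ vset n (start.run s) 4 ↔
      G.InStart (vset n s 1) (scoreOf G) (bits n s) a w := by
  refine (loop_induction (n := n) (r := 16) (s := s)
    (fun k s' => Holds G s' ∧ s'.reg 17 = a ∧ s'.mem 1 = s.mem 1 ∧ s'.mem 3 = s.mem 3 ∧
      ∀ w : Fin n, w < k → (w ∈ vset n s' 4 ↔
        G.InStart (vset n s 1) (scoreOf G) (bits n s) a w))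
    (by decide) (by decide) h.size ⟨h, ha, rfl, rfl, by simp⟩ ?_).2.2.2.2 w w.2
  intro k hk s' hn ⟨h1, h2, h3, h4, h5⟩
  set v : Fin n := ⟨k, hk⟩ with hv
  set s₁ := s'.setReg 16 k with hs₁
  have hh₁ : Holds G s₁ := h1.setReg (by decide) _
  refine ⟨hh₁.run (by decide) (by decide), by rw [reg_run (by decide)]; simpa [hs₁] using h2,
    by rw [mem_run (by decide)]; exact h3, by rw [mem_run (by decide)]; exact h4, fun w hw => ?_⟩
  have e1 : vset n s₁ 1 = vset n s 1 := by ext; simp [On, hs₁, h3]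
  have e3 : bits n s₁ = bits n s := by ext; simp [bits, On, hs₁, h4]
  rw [run_put, mem_vset, on_setMem]
  simp only [eval_var, true_and, show s₁.reg 16 = k by simp [hs₁]]
  split_ifs with hwk
  · have hwv : w = v := Fin.ext hwk
    rw [hwv, ← e1, ← e3]
    exact hh₁.tr_inStart (by decide) (by decide) (by simpa [hs₁] using h2) (by simp [hs₁, hv])
  · rw [hs₁, on_setReg, ← mem_vset]
    exact h5 w (by omega)

/-- Only entries of the relation on `X × X` are decoded; leftovers in array `3` elsewhere do no
harm. -/
theorem inStart_congr {X : Finset (Fin n)} {score : Fin n → ℕ} {b b' : Fin n → Fin n → Prop}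
    (h : ∀ x ∈ X, ∀ y ∈ X, b x y ↔ b' x y) (a w : Fin n) :
    G.InStart X score b a w ↔ G.InStart X score b' a w := by
  refine or_congr_left (and_congr_right fun ha => or_congr
    (and_congr_right fun hw => h a ha w hw) (and_congr_right fun _ => exists_congr fun x =>
      and_congr_right fun hx => and_congr_right fun _ => and_congr
        (exists_congr fun y => and_congr_right fun hy => h x hx y hy)
        (forall₂_congr fun y hy => iff_congr Iff.rfl (h x hx y hy))))

/-- The guess `b`, `a` leads to a cut of size at least `T`. -/
def GuessLeads (G : SimpleGraph (Fin n)) (X : Finset (Fin n)) (b : Fin n → Fin n → Prop)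
    (a : Fin n) (T : ℕ) : Prop :=
  ∀ A₀ : Finset (Fin n), (∀ w, w ∈ A₀ ↔ G.InStart X (scoreOf G) b a w) → G.Leads X A₀ T

theorem GuessLeads.congr {X : Finset (Fin n)} {b b' : Fin n → Fin n → Prop} {a : Fin n} {T : ℕ}
    (hb : GuessLeads G X b a T) (h : ∀ x ∈ X, ∀ y ∈ X, b x y ↔ b' x y) :
    GuessLeads G X b' a T :=
  fun A₀ hA₀ => hb A₀ fun w => (hA₀ w).trans (inStart_congr h a w).symm

theorem round_spec {s : State} (h : Holds G s) (hX : G.IsTwinCover (vset n s 1)) :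
    s.reg 6 ≤ (round.run s).reg 6 ∧
    ((round.run s).reg 6 = s.reg 6 ∨ ∃ A, (round.run s).reg 6 = G.valueOf A) ∧
    ∀ a T, GuessLeads G (vset n s 1) (bits n (decode.run s)) a T →
      T + 1 ≤ (round.run s).reg 6 := by
  set X := vset n s 1 with hXdef
  set b := bits n (decode.run s) with hb
  have hh : Holds G (decode.run s) := h.run (by decide) (by decide)
  have r6 : (decode.run s).reg 6 = s.reg 6 := reg_run (by decide) s
  rw [round, run_seq]
  have key := loop_induction (n := n) (r := 17)
    (c := seq start (seq greedy (cond ((var 6).lt (var 7)) (set 6 (var 7)) (set 9 (lit 0)))))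
    (s := decode.run s)
    (fun k s' => Holds G s' ∧ vset n s' 1 = X ∧ bits n s' = b ∧ s.reg 6 ≤ s'.reg 6 ∧
      (s'.reg 6 = s.reg 6 ∨ ∃ A, s'.reg 6 = G.valueOf A) ∧
      ∀ a : Fin n, a < k → ∀ T, GuessLeads G X b a T → T + 1 ≤ s'.reg 6)
    (by decide) (by decide) hh.size
    ⟨hh, vset_run (by decide) n s, rfl, r6.ge, Or.inl r6, by simp⟩ ?_
  · exact ⟨key.2.2.2.1, key.2.2.2.2.1, fun a => key.2.2.2.2.2 a a.2⟩
  · intro k hk s' hn ⟨h1, h2, h3, h4, h5, h6⟩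
    set a : Fin n := ⟨k, hk⟩ with ha
    set s₁ := s'.setReg 17 k with hs₁
    have hh₁ : Holds G s₁ := h1.setReg (by decide) _
    have e1 : vset n s₁ 1 = X := h2
    have e3 : bits n s₁ = b := h3
    refine ⟨hh₁.run (by decide) (by decide), (vset_run (by decide) n s₁).trans e1, ?_, ?_⟩
    · ext i j
      rw [bits, on_run (by decide), ← e3]
      rfl
    set s₂ := start.run s₁ with hs₂
    have hh₂ : Holds G s₂ := hh₁.run (by decide) (by decide)
    have e2 : vset n s₂ 1 = X := (vset_run (by decide) n s₁).trans e1
    have hst := start_spec hh₁ (a := a) (by simp [hs₁, ha])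
    rw [e1, e3, ← hs₂] at hst
    obtain ⟨⟨A, hA⟩, g2⟩ := greedy_spec hh₂ (by rw [e2]; exact hX)
    rw [e2] at g2
    set s₃ := greedy.run s₂ with hs₃
    have r6' : s₃.reg 6 = s'.reg 6 := by
      rw [hs₃, reg_run (by decide), hs₂, reg_run (by decide)]
      simp [hs₁]
    have hT : ∀ T, GuessLeads G X b a T → T + 1 ≤ s₃.reg 7 := fun T hT => g2 T (hT _ hst)
    have hlt : ∀ w : Fin n, (w : ℕ) < k + 1 → (w : ℕ) < k ∨ w = a := fun w hw =>
      (Nat.lt_succ_iff_lt_or_eq.1 hw).imp_right fun h => Fin.ext h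
    have hfin : ∀ m, s'.reg 6 ≤ m → s₃.reg 7 ≤ m →
        ∀ w : Fin n, (w : ℕ) < k + 1 → ∀ T, GuessLeads G X b w T → T + 1 ≤ m := by
      intro m hm hm' w hw T hwT
      rcases hlt w hw with hw | rfl
      · exact (h6 w hw T hwT).trans hm
      · exact (hT T hwT).trans hm'
    rw [run_seq, run_seq, run_cond, ← hs₂, ← hs₃]
    simp only [tr_lt, eval_var, r6']
    split_ifs with hc
    · simp only [run_set, eval_var, State.reg_setReg, if_true]
      exact ⟨h4.trans hc.le, Or.inr ⟨A, hA⟩, hfin _ hc.le le_rfl⟩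
    · simp only [run_set, State.reg_setReg, if_neg (show 6 ≠ 9 by decide), r6']
      exact ⟨h4, h5, hfin _ le_rfl (not_lt.1 hc)⟩

end Cmd
end RAM

/-! ### The complete algorithm and its running time. -/

namespace RAM
open Ex Cmd

variable {n : ℕ} {G : SimpleGraph (Fin n)}

theorem holds_input (G : SimpleGraph (Fin n)) (k : ℤ) : Holds G (input G k) := by
  refine ⟨by simp [input], fun i j => ?_⟩
  have : (∃ i' j' : Fin n, G.Adj i' j' ∧ n * (i : ℕ) + j = (i' : ℕ) * n + j') ↔ G.Adj i j := by
    refine ⟨?_, fun h => ⟨i, j, h, by rw [mul_comm]⟩⟩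
    rintro ⟨i', j', h, e⟩
    rw [mul_comm (i' : ℕ)] at e
    obtain ⟨rfl, rfl⟩ := (pair_lt_succ_iff.1 (Nat.lt_succ_of_le e.le)).resolve_left (by omega)
    exact h
  simp [On, input, this]

/-- Decide whether the best value exceeds the bound. -/
def answer : Ex := cond ((var 1).lt (var 6)) (lit 1) (lit 0)

/-- The algorithm for Connected Maximum Cut. -/
def connectedMaxCut : Program :=
  .seq (prepare.code 40) <| .seq (forCode 4 3 (round.code 42) 40) <|
    .seq (answer.code 40) <| .seq (.const 0 0) (.add 0 0 40)

theorem prepare_spec (G : SimpleGraph (Fin n)) (k : ℤ) :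
    let σ := prepare.run (input G k)
    Holds G σ ∧ G.IsTwinCover (vset n σ 1) ∧ (vset n σ 1).card ≤ 2 * G.twinCoverNumber ∧
      σ.reg 1 = k.toNat ∧ σ.reg 6 = 0 ∧ σ.reg 3 = weight (PairInX n σ) (n * n) ∧
      ∀ i j : Fin n, i ∈ vset n σ 1 → j ∈ vset n σ 1 →
        σ.mem 2 (n * i + j) = weight (PairInX n σ) (n * i + j) := by
  intro σ
  have h0 := holds_input G k
  have hc : Holds G (cover.run (input G k)) := h0.run (by decide) (by decide)
  have hm : σ.mem 1 = (cover.run (input G k)).mem 1 := mem_run (c := powers) (by decide) _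
  have hv : vset n σ 1 = vset n (cover.run (input G k)) 1 := by ext; simp [On, hm]
  obtain ⟨c1, c2⟩ := cover_spec h0 (by ext; simp [On, input])
  obtain ⟨p1, p2⟩ := powers_spec hc
  rw [← hv] at c1 c2 p2
  rw [← pairInX_congr hm] at p1 p2
  exact ⟨h0.run (by decide) (by decide), c1, c2,
    (reg_run (c := prepare) (by decide) _).trans (by simp [input]),
    (reg_run (c := prepare) (by decide) _).trans (by simp [input]), p1, p2⟩

theorem rounds_spec {σ : State} {m : ℕ} (h : Holds G σ) (hX : G.IsTwinCover (vset n σ 1))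
    (h6 : σ.reg 6 = 0)
    (hw : ∀ i j : Fin n, i ∈ vset n σ 1 → j ∈ vset n σ 1 →
        σ.mem 2 (n * i + j) = weight (PairInX n σ) (n * i + j))
    (hm : m = weight (PairInX n σ) (n * n)) :
    let σ' := forRun (fun i s => round.run (s.setReg 4 i)) m σ
    Holds G σ' ∧ σ'.reg 1 = σ.reg 1 ∧ (σ'.reg 6 = 0 ∨ ∃ A, σ'.reg 6 = G.valueOf A) ∧
      ∀ b a T, GuessLeads G (vset n σ 1) b a T → T + 1 ≤ σ'.reg 6 := by
  intro σ'
  set D := PairInX n σ with hD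
  set X := vset n σ 1 with hXdef
  have key := forRun_induction (f := fun i s => round.run (s.setReg 4 i)) (n := m) (s := σ)
    (fun k s => Holds G s ∧ s.reg 1 = σ.reg 1 ∧ s.mem 1 = σ.mem 1 ∧ s.mem 2 = σ.mem 2 ∧
      (s.reg 6 = 0 ∨ ∃ A, s.reg 6 = G.valueOf A) ∧
      -- Every guess whose number has already been counted is accounted for in register `6`.
      ∀ c < k, ∀ b : ℕ → Prop, c = encode D b (n * n) → ∀ a T,
        GuessLeads G X (fun i j => b (n * i + j)) a T → T + 1 ≤ s.reg 6)
    ⟨h, rfl, rfl, rfl, Or.inl h6, by simp⟩ ?_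
  · obtain ⟨g1, g2, -, -, g3, g4⟩ := key
    refine ⟨g1, g2, g3, fun b a T hb => ?_⟩
    refine g4 _ (hm ▸ encode_lt_weight D
      (fun p => ∃ i j : Fin n, p = n * i + j ∧ b i j) (n * n)) _ rfl a T
      (hb.congr fun x _ y _ => ⟨fun h => ⟨x, y, rfl, h⟩, ?_⟩)
    rintro ⟨i, j, e, h⟩
    obtain ⟨rfl, rfl⟩ := (pair_lt_succ_iff.1 (Nat.lt_succ_of_le e.le)).resolve_left (by omega)
    exact h
  · intro c hc s ⟨g1, g2, g3, g4, g5, g6⟩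
    set s₁ := s.setReg 4 c with hs₁
    have hh₁ : Holds G s₁ := g1.setReg (by decide) _
    have hm1 : s₁.mem 1 = σ.mem 1 := g3
    have hv : vset n s₁ 1 = X := by ext; simp [hXdef, On, hm1]
    obtain ⟨r1, r2, r3⟩ := round_spec hh₁ (by rw [hv]; exact hX)
    have e6 : s₁.reg 6 = s.reg 6 := by simp [hs₁]
    rw [e6] at r1 r2
    refine ⟨hh₁.run (by decide) (by decide), ?_, ?_, ?_, ?_, fun c' hc' b hb a T hT => ?_⟩
    · exact (reg_run (c := round) (by decide) _).trans (by simpa [hs₁] using g2)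
    · exact (mem_run (c := round) (by decide) _).trans g3
    · exact (mem_run (c := round) (by decide) _).trans g4
    · rcases r2 with r2 | r2
      · rcases g5 with g5 | ⟨A, hA⟩
        · exact Or.inl (r2.trans g5)
        · exact Or.inr ⟨A, r2.trans hA⟩
      · exact Or.inr r2
    · rcases Nat.lt_succ_iff_lt_or_eq.1 hc' with hc' | rfl
      · exact (g6 c' hc' b hb a T hT).trans r1
      · rw [hv] at r3
        refine r3 a T (hT.congr fun x hx y hy => ?_)
        rw [decode_spec hh₁ (D := D) (pairInX_congr hm1).symm (b := b) ?_ (by simp [hs₁, hb])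
          (hv ▸ hx) (hv ▸ hy)]
        rw [hv, show s₁.mem 2 = σ.mem 2 from g4]
        exact hw

/-- From `t = 8` on, `4 * t ^ 2 ≤ 2 ^ t`; the constant `100` covers the smaller values. It becomes
the factor `2 ^ 100` of the polynomial. -/
theorem four_mul_sq_le (t : ℕ) : (2 * t) ^ 2 ≤ 100 + (2 ^ t + t) := by
  rcases Nat.lt_or_ge t 8 with h | h
  · interval_cases t <;> norm_num
  · have : 4 * t ^ 2 ≤ 2 ^ t := by
      induction t, h using Nat.le_induction with
      | base => norm_num
      | succ t ht ih => rw [pow_succ 2 t]; nlinarith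
    nlinarith

theorem connectedMaxCut_spec (G : SimpleGraph (Fin n)) (k : ℤ) :
    Runs connectedMaxCut (input G k)
      (prepare.cost.eval n + (2 ^ 100 * 2 ^ (2 ^ G.twinCoverNumber + G.twinCoverNumber) *
        (round.cost.eval n + 6) + 3 + (answer.cost.eval n + (1 + 1))))
      fun s => (s.reg 0 = 1 ∧ G.HasConnectedCut k) ∨ (s.reg 0 = 0 ∧ ¬ G.HasConnectedCut k) := by
  classical
  obtain ⟨p1, p2, p3, p4, p5, p6, p7⟩ := prepare_spec G k
  set σ := prepare.run (input G k) with hσ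
  obtain ⟨q1, q2, q3, q4⟩ := rounds_spec p1 p2 p5 p7 p6
  set σ' := forRun (fun i s => round.run (s.setReg 4 i)) (σ.reg 3) σ with hσ'
  have hK : 0 < numVars := by decide
  have hn : (input G k).reg 0 = n := (holds_input G k).size
  refine ((Cmd.runs_code wf_prepare (d := 40) le_rfl (s := input G k) (σ := input G k)
    ⟨fun _ _ => rfl, rfl⟩).mono (le_of_eq (by rw [hn])) fun s h => h).seq fun s₁ g₁ => ?_
  have n₁ : s₁.reg 0 = n := by rw [g₁.1.1 0 hK]; exact p1.size
  have m₁ : s₁.reg 3 = σ.reg 3 := g₁.1.1 3 (by decide)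
  have hM : s₁.reg 3 ≤ 2 ^ 100 * 2 ^ (2 ^ G.twinCoverNumber + G.twinCoverNumber) := by
    rw [m₁, p6, ← pow_add]
    exact (weight_pairInX_le n σ).trans (Nat.pow_le_pow_right two_pos
      ((Nat.pow_le_pow_left p3 2).trans (four_mul_sq_le _)))
  have hloop := runs_forCode (r := 4) (b := 3) (d := 40) (n := n) (C := round.cost.eval n)
    (p := round.code 42) (f := round.run) le_rfl (by decide) (by decide) (by decide)
    (reg_run (by decide))
    (fun s τ hs hτ => (Cmd.runs_code wf_round (d := 42) (by decide) hτ).mono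
      (by rw [hs]) fun s h => h) n₁ g₁.1
  refine (hloop.mono (D := 2 ^ 100 * 2 ^ (2 ^ G.twinCoverNumber + G.twinCoverNumber) *
    (round.cost.eval n + 6) + 3) (Nat.add_le_add_right (Nat.mul_le_mul_right _ hM) 3)
    fun s h => h).seq fun s₂ g₂ => ?_
  rw [m₁, ← hσ'] at g₂
  have n₂ : s₂.reg 0 = n := by rw [g₂.1.1 0 hK]; exact q1.size
  refine ((Ex.runs_code (e := answer) (by decide) (d := 40) le_rfl s₂).mono
    (le_of_eq (by rw [n₂])) fun s h => h).seq fun s₃ g₃ =>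
    Runs.seq (Runs.const (P := fun s₄ => s₄ = s₃.setReg 0 0) rfl) fun s₄ g₄ => Runs.add ?_
  have hans : answer.eval s₂ = if k.toNat < σ'.reg 6 then 1 else 0 := by
    rw [Ex.eval_congr (e := answer) (by decide) g₂.1, answer, eval_cond]
    simp only [tr_lt, eval_var, eval_lit, q2, p4]
  have hres : ((s₄.setReg 0 (s₄.reg 0 + s₄.reg 40))).reg 0 =
      if k.toNat < σ'.reg 6 then 1 else 0 := by
    subst g₄
    simp [g₃.1, hans]
  -- Values are cut sizes plus one, whence the strict inequality. For `k ≤ 0` it says that some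
  -- connected set was found.
  have hiff : k.toNat < σ'.reg 6 ↔ G.HasConnectedCut k := by
    constructor
    · intro hlt
      obtain ⟨A, hA⟩ := q3.resolve_left (by omega)
      rw [hA, SimpleGraph.valueOf] at hlt
      split_ifs at hlt with hc
      · refine ⟨A, hc, ?_⟩
        rw [SimpleGraph.cutSize_eq_cutSum]
        omega
      · omega
    · rintro ⟨S, hS, hk⟩
      lift S to Finset (Fin n) using S.toFinite
      rw [SimpleGraph.cutSize_eq_cutSum] at hk
      obtain ⟨b, a, hba⟩ := SimpleGraph.exists_start p2 (scoreOf_injective G)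
        (fun _ _ => degIn_le_of_scoreOf_le) hS
      have := q4 b a _ hba
      omega
  by_cases hc : G.HasConnectedCut k
  · exact Or.inl ⟨by rw [hres, if_pos (hiff.2 hc)], hc⟩
  · exact Or.inr ⟨by rw [hres, if_neg (mt hiff.1 hc)], hc⟩

end RAM

open scoped Classical in
theorem mainTheorem8 :
    ∃ (p : RAM.Program) (q : Polynomial ℕ),
      ∀ (n : ℕ) (G : SimpleGraph (Fin n)) (k : ℤ),
        ∃ (t : ℕ) (s : RAM.State),
          RAM.Exec p (RAM.input G k) t s ∧
          t ≤ q.eval n * 2 ^ (2 ^ G.twinCoverNumber + G.twinCoverNumber) ∧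
          s.reg 0 = (if G.HasConnectedCut k then 1 else 0) := by
  refine ⟨RAM.connectedMaxCut, RAM.Cmd.prepare.cost +
    (Polynomial.C (2 ^ 100) * (RAM.Cmd.round.cost + 6) + 3 + (RAM.answer.cost + 2)),
    fun n G k => ?_⟩
  obtain ⟨t, s, h, ht, hs⟩ := RAM.connectedMaxCut_spec G k
  refine ⟨t, s, h, ht.trans ?_, ?_⟩
  · simp only [Polynomial.eval_add, Polynomial.eval_mul, Polynomial.eval_C, Polynomial.eval_ofNat]
    have hE := Nat.one_le_two_pow (n := 2 ^ G.twinCoverNumber + G.twinCoverNumber)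
    generalize 2 ^ (2 ^ G.twinCoverNumber + G.twinCoverNumber) = E at hE ⊢
    generalize (2 : ℕ) ^ 100 = F
    generalize RAM.Cmd.prepare.cost.eval n = P
    generalize RAM.Cmd.round.cost.eval n = R
    generalize RAM.answer.cost.eval n = A
    -- The costs outside the loop are absorbed using that the exponential factor is at least one.
    have h1 := Nat.le_mul_of_pos_right P hE
    have h2 := Nat.le_mul_of_pos_right (3 + (A + 2)) hE
    calc P + (F * E * (R + 6) + 3 + (A + (1 + 1)))
        = P + F * E * (R + 6) + (3 + (A + 2)) := by ring
      _ ≤ P * E + F * E * (R + 6) + (3 + (A + 2)) * E := by omega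
      _ = _ := by ring
  · rcases hs with ⟨hs, hc⟩ | ⟨hs, hc⟩
    · rw [hs, if_pos hc]
    · rw [hs, if_neg hc]
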